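/- Maps are considered on compact oriented surfaces without boundary, loops and multiple edges are allowed, all faces are discs, and two maps (with their basepoints or labels) are identified if an orientation-preserving homeomorphism of the surfaces takes one to the other. A quadrangulation is a map all of whose faces have degree 4; it is bipartite if its vertices can be coloured with two colours so that adjacent vertices have different colours; it is pointed if a vertex $v_0$, the basepoint, is distinguished. A $g$-tree is a map of genus $g$ with exactly one face. It is well labeled if its vertices carry integer labels that differ by at most $1$ along every edge, and the set of the labels is $\{1,\dots,m\}$ for some $m\ge 1$. Let $(\mathfrak q,v_0)$ be a pointed bipartite quadrangulation, and label each vertex by its graph distance to $v_0$. Labels of adjacent vertices then differ by one, and the labels read clockwise around a face are $(j-1,j,j-1,j)$ or $(j-1,j,j+1,j)$ for some $j\ge 1$, so each face has exactly two corners whose label is larger than that of the preceding corner in clockwise order around the face. The opening $\phi(\mathfrak q,v_0)$ is the labeled graph drawing whose vertices are the vertices of $\mathfrak q$ other than $v_0$, with these labels, and which has one edge in each face of $\mathfrak q$, joining these two corners of the face. **Theorem.** Let $g\ge 0$, $n\ge 1$ and $i\ge 0$ be integers. Every bipartite quadrangulation of genus $g$ with $n$ faces has $2n$ edges and $n+2-2g$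 vertices, and every well labeled $g$-tree with $n$ edges has $n+1-2g$ vertices. The opening $\phi$ is a well-defined bijection from the set of pointed bipartite quadrangulations of genus $g$ with $n$ faces, $i$ of whose vertices are at odd distance of the basepoint, onto the set of well labeled $g$-trees with $n$ edges, $i$ of whose vertices have odd labels. The vertices of $\phi(\mathfrak q,v_0)$ are the vertices of $\mathfrak q$ other than $v_0$, and their labels are their graph distances to $v_0$ in $\mathfrak q$. -/

import Mathlib

universe u

theorem exists_return {α : Type u} [Finite α] (f : Equiv.Perm α) (p : α → Prop)
    (x : {x : α // p x}) : ∃ k : ℕ, p ((f ^ (k + 1)) x.1) := by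
  refine ⟨orderOf f - 1, ?_⟩
  have h : 0 < orderOf f := orderOf_pos f
  rw [Nat.sub_add_cancel h, pow_orderOf_eq_one]
  exact x.2

open Classical in
/-- The first of `f x, f (f x), …` that satisfies `p`. -/
noncomputable def nextReturn {α : Type u} [Finite α] (f : Equiv.Perm α) (p : α → Prop)
    (x : {x : α // p x}) : {x : α // p x} :=
  ⟨(f ^ (Nat.find (exists_return f p x) + 1)) x.1, Nat.find_spec (exists_return f p x)⟩

theorem nextReturn_injective {α : Type u} [Finite α] (f : Equiv.Perm α) (p : α → Prop) :
    Function.Injective (nextReturn f p) := by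
  classical
  have key : ∀ x y : {x : α // p x}, nextReturn f p x = nextReturn f p y →
      Nat.find (exists_return f p x) ≤ Nat.find (exists_return f p y) → x = y := by
    intro x y hxy hle
    obtain ⟨j, hj⟩ := Nat.exists_eq_add_of_le hle
    have h1 : (f ^ (Nat.find (exists_return f p x) + 1)) x.1
        = (f ^ (Nat.find (exists_return f p y) + 1)) y.1 := congrArg Subtype.val hxy
    have h2 : Nat.find (exists_return f p y) + 1
        = (Nat.find (exists_return f p x) + 1) + j := by omega
    rw [h2, pow_add _ (_ + 1) j, Equiv.Perm.mul_apply] at h1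
    have h3 : x.1 = (f ^ j) y.1 := (f ^ (Nat.find (exists_return f p x) + 1)).injective h1
    cases j with
    | zero => exact Subtype.ext (by simpa using h3)
    | succ j =>
      exact absurd (h3 ▸ x.2) (Nat.find_min (exists_return f p y) (m := j) (by omega))
  intro x y hxy
  rcases le_total (Nat.find (exists_return f p x)) (Nat.find (exists_return f p y)) with h | h
  · exact key x y hxy h
  · exact (key y x hxy.symm h).symm

/-- The permutation induced by `f` on the elements that satisfy `p`: the cyclic order of every
cycle of `f` is kept, and the elements that do not satisfy `p` are skipped. -/
noncomputable def firstReturn {α : Type u} [Finite α] (f : Equiv.Perm α) (p : α → Prop) :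
    Equiv.Perm {x : α // p x} :=
  Equiv.ofBijective (nextReturn f p)
    (Finite.injective_iff_bijective.mp (nextReturn_injective f p))

theorem firstReturn_sameCycle {α : Type u} [Finite α] (f : Equiv.Perm α) (p : α → Prop)
    (x : {x : α // p x}) : f.SameCycle x.1 (firstReturn f p x).1 := by
  classical
  exact ⟨((Nat.find (exists_return f p x) + 1 : ℕ) : ℤ), by
    rw [zpow_natCast]
    simp only [firstReturn, nextReturn, Equiv.ofBijective_apply]⟩

/-- A graph drawn on oriented surfaces, given combinatorially by its arcs (here called darts):
`rot` sends an arc to the next arc in counterclockwise order around its origin, and `opp` reverses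
an arc. Loops and multiple edges are allowed. Connectedness is not required at this point. -/
structure RotationSystem where
  Dart : Type u
  finite : Finite Dart
  rot : Equiv.Perm Dart
  opp : Equiv.Perm Dart
  opp_opp : ∀ d, opp (opp d) = d
  opp_ne : ∀ d, opp d ≠ d

attribute [instance] RotationSystem.finite

namespace RotationSystem

variable (M : RotationSystem.{u})

/-- Vertices are the cycles of `rot`. -/
def Vertex : Type u := Quotient (Equiv.Perm.SameCycle.setoid M.rot)

/-- Edges are the pairs of opposite arcs. -/
def Edge : Type u := Quotient (Equiv.Perm.SameCycle.setoid M.opp)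

/-- The border of the face on the right-hand side of an arc, in clockwise direction (that is, with
the face on the right): after the arc `d` comes the arc that follows `opp d` counterclockwise
around the end of `d`. -/
def faceNext : Equiv.Perm M.Dart := M.rot * M.opp

/-- Faces are the cycles of `faceNext`. -/
def Face : Type u := Quotient (Equiv.Perm.SameCycle.setoid M.faceNext)

/-- The origin of an arc. -/
def origin (d : M.Dart) : M.Vertex := Quotient.mk (Equiv.Perm.SameCycle.setoid M.rot) d

/-- The face on the right-hand side of an arc. -/
def rightFace (d : M.Dart) : M.Face := Quotient.mk (Equiv.Perm.SameCycle.setoid M.faceNext) d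

/-- The degree of a face: the number of edges incident to it, an edge that has the face on both
sides being counted twice. -/
noncomputable def faceDegree (f : M.Face) : ℕ := Nat.card {d : M.Dart // M.rightFace d = f}

/-- A map (with at least one edge): the drawing is connected. -/
def IsMap : Prop :=
  Nonempty M.Dart ∧
    ∀ d e : M.Dart, ∃ p ∈ Subgroup.closure ({M.rot, M.opp} : Set (Equiv.Perm M.Dart)), p d = e

/-- A map of genus `g`: the surface on which it is drawn, which has one disc for each face, has
Euler characteristic `2 - 2g`. -/
def IsMapOfGenus (g : ℕ) : Prop :=
  M.IsMap ∧
    (Nat.card M.Vertex : ℤ) - (Nat.card M.Edge : ℤ) + (Nat.card M.Face : ℤ) = 2 - 2 * (g : ℤ)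

/-- All faces have degree 4. -/
def IsQuadrangular : Prop := ∀ f : M.Face, M.faceDegree f = 4

/-- The vertices can be coloured with two colours such that adjacent ones differ in colour. -/
def IsBipartite : Prop :=
  ∃ c : M.Vertex → Bool, ∀ d : M.Dart, c (M.origin d) ≠ c (M.origin (M.opp d))

/-- The underlying graph (loops and multiplicities of edges do not matter for distances). -/
def graph : SimpleGraph M.Vertex :=
  SimpleGraph.fromRel fun u v => ∃ d : M.Dart, M.origin d = u ∧ M.origin (M.opp d) = v

/-- Orientation-preserving isomorphisms of drawings: the bijections between the arcs that respect
the cyclic order around vertices and the reversal of arcs. -/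
structure Iso (M N : RotationSystem.{u}) where
  toEquiv : M.Dart ≃ N.Dart
  map_rot : ∀ d, toEquiv (M.rot d) = N.rot (toEquiv d)
  map_opp : ∀ d, toEquiv (M.opp d) = N.opp (toEquiv d)

/-- The identity. -/
def Iso.refl (M : RotationSystem.{u}) : Iso M M :=
  ⟨Equiv.refl _, fun _ => rfl, fun _ => rfl⟩

/-- The inverse of an isomorphism. -/
def Iso.symm {M N : RotationSystem.{u}} (e : Iso M N) : Iso N M :=
  ⟨e.toEquiv.symm,
    fun d => e.toEquiv.injective (by rw [e.map_rot]; simp),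
    fun d => e.toEquiv.injective (by rw [e.map_opp]; simp)⟩

/-- The composition of two isomorphisms. -/
def Iso.trans {M N P : RotationSystem.{u}} (e : Iso M N) (f : Iso N P) : Iso M P :=
  ⟨e.toEquiv.trans f.toEquiv,
    fun d => by simp [e.map_rot, f.map_rot],
    fun d => by simp [e.map_opp, f.map_opp]⟩

end RotationSystem

/-- A drawing with a distinguished vertex, the basepoint. -/
structure PointedDrawing extends RotationSystem.{u} where
  base : toRotationSystem.Vertex

/-- A drawing with integer labels on its vertices. -/
structure LabeledDrawing extends RotationSystem.{u} where
  label : toRotationSystem.Vertex → ℤ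

/-- Isomorphic pointed drawings: some isomorphism sends the basepoint to the basepoint. -/
def PointedDrawing.Equivalent (M N : PointedDrawing.{u}) : Prop :=
  ∃ e : RotationSystem.Iso M.toRotationSystem N.toRotationSystem,
    ∀ d, M.origin d = M.base ↔ N.origin (e.toEquiv d) = N.base

/-- Isomorphic labeled drawings: some isomorphism preserves the labels. -/
def LabeledDrawing.Equivalent (S T : LabeledDrawing.{u}) : Prop :=
  ∃ e : RotationSystem.Iso S.toRotationSystem T.toRotationSystem,
    ∀ d, S.label (S.origin d) = T.label (T.origin (e.toEquiv d))

theorem PointedDrawing.equivalent_equivalence :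
    Equivalence PointedDrawing.Equivalent.{u} where
  refl M := ⟨RotationSystem.Iso.refl _, fun _ => Iff.rfl⟩
  symm := by
    rintro M N ⟨e, he⟩
    refine ⟨e.symm, fun d => ?_⟩
    have := he (e.toEquiv.symm d)
    rw [Equiv.apply_symm_apply] at this
    exact this.symm
  trans := by
    rintro M N P ⟨e, he⟩ ⟨f, hf⟩
    exact ⟨e.trans f, fun d => (he d).trans (hf _)⟩

theorem LabeledDrawing.equivalent_equivalence :
    Equivalence LabeledDrawing.Equivalent.{u} where
  refl M := ⟨RotationSystem.Iso.refl _, fun _ => rfl⟩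
  symm := by
    rintro M N ⟨e, he⟩
    refine ⟨e.symm, fun d => ?_⟩
    have := he (e.toEquiv.symm d)
    rw [Equiv.apply_symm_apply] at this
    exact this.symm
  trans := by
    rintro M N P ⟨e, he⟩ ⟨f, hf⟩
    exact ⟨e.trans f, fun d => (he d).trans (hf _)⟩

namespace PointedDrawing

variable (M : PointedDrawing.{u})

/-- The distance labelling: the distance of a vertex to the basepoint. -/
noncomputable def distLabel (v : M.Vertex) : ℕ := M.graph.dist M.base v

/-- Pointed bipartite quadrangulations of genus `g` with `n` faces, `i` of whose vertices are at
odd distance of the basepoint. -/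
def IsBipartiteQuadrangulation (g n i : ℕ) : Prop :=
  M.IsMapOfGenus g ∧ M.IsQuadrangular ∧ M.IsBipartite ∧
    Nat.card M.Face = n ∧ Nat.card {v : M.Vertex // Odd (M.distLabel v)} = i

/-- A corner of a face `f` is represented by the arc `d` that leaves the corner in the clockwise
tour of `f`, so `f` is the face on the right of `d` and the corner is the sector at the origin of
`d` between `rot⁻¹ d` and `d`. The corner that precedes it in clockwise direction around `f` is
`faceNext⁻¹ d`. The corner is rising if its label is larger than the one of this predecessor. -/
def IsRising (d : M.Dart) : Prop :=
  M.distLabel (M.origin (M.faceNext⁻¹ d)) < M.distLabel (M.origin d)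

/-- The rising corners of the face on the right of `d`. -/
def risingCorners (d : M.Dart) : Set M.Dart :=
  {e | M.rightFace e = M.rightFace d ∧ M.IsRising e}

/-- The opening draws one edge in each face that has exactly two rising corners (in a pointed
bipartite quadrangulation every face is of this kind), and this edge connects these two corners:
its two arcs are represented by the two corners. -/
def IsOpeningCorner (d : M.Dart) : Prop :=
  M.IsRising d ∧ (M.risingCorners d).ncard = 2

/-- The arcs of the opening: an arc starts in each of the corners above. -/
def OpeningDart : Type u := {d : M.Dart // M.IsOpeningCorner d}

theorem exists_partner (d : M.OpeningDart) :
    ∃ e : M.OpeningDart, e ≠ d ∧ M.rightFace e.1 = M.rightFace d.1 := by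
  obtain ⟨x, hx, hxd⟩ := Set.exists_ne_of_one_lt_ncard (by rw [d.2.2]; norm_num :
    1 < (M.risingCorners d.1).ncard) d.1
  have h : M.risingCorners x = M.risingCorners d.1 := by
    unfold risingCorners
    rw [hx.1]
  exact ⟨⟨x, hx.2, by rw [h]; exact d.2.2⟩, fun h => hxd (congrArg Subtype.val h), hx.1⟩

theorem partner_unique {d e e' : M.OpeningDart} (h1 : e ≠ d)
    (h2 : M.rightFace e.1 = M.rightFace d.1) (h1' : e' ≠ d) (h2' : M.rightFace e'.1 = M.rightFace d.1) : e = e' := by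
  by_contra hne
  have hsub : ({d.1, e.1, e'.1} : Set M.Dart) ⊆ M.risingCorners d.1 := by
    rintro x (rfl | rfl | rfl)
    · exact ⟨rfl, d.2.1⟩
    · exact ⟨h2, e.2.1⟩
    · exact ⟨h2', e'.2.1⟩
  have hcard : ({d.1, e.1, e'.1} : Set M.Dart).ncard = 3 :=
    Set.ncard_eq_three.mpr ⟨d.1, e.1, e'.1, fun h => h1 (Subtype.ext h.symm),
      fun h => h1' (Subtype.ext h.symm), fun h => hne (Subtype.ext h), rfl⟩
  have := Set.ncard_le_ncard hsub (Set.toFinite _)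
  rw [hcard, d.2.2] at this
  omega

/-- The other end of the new edge: the other rising corner of the same face. -/
noncomputable def partner (d : M.OpeningDart) : M.OpeningDart := (M.exists_partner d).choose

theorem partner_ne (d : M.OpeningDart) : M.partner d ≠ d := (M.exists_partner d).choose_spec.1

theorem rightFace_partner (d : M.OpeningDart) :
    M.rightFace (M.partner d).1 = M.rightFace d.1 := (M.exists_partner d).choose_spec.2

theorem partner_partner (d : M.OpeningDart) : M.partner (M.partner d) = d :=
  M.partner_unique (M.partner_ne _) (M.rightFace_partner _) (M.partner_ne d).symm
    (M.rightFace_partner d).symm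

/-- The opening, as a drawing: around each vertex, the new arcs are in the counterclockwise order
of the corners in which they start. -/
noncomputable def openingDrawing : RotationSystem.{u} where
  Dart := M.OpeningDart
  finite := inferInstanceAs (Finite {d : M.Dart // M.IsOpeningCorner d})
  rot := firstReturn M.rot M.IsOpeningCorner
  opp := Function.Involutive.toPerm M.partner M.partner_partner
  opp_opp := M.partner_partner
  opp_ne := M.partner_ne

/-- The vertices of the opening are vertices of the given drawing: an arc of the opening starts at
the vertex at which its corner lies. -/
noncomputable def openingVertex : M.openingDrawing.Vertex → M.Vertex :=
  Quotient.lift (fun d : M.OpeningDart => M.origin d.1) (by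
    have step : ∀ d : M.OpeningDart,
        M.origin (firstReturn M.rot M.IsOpeningCorner d).1 = M.origin d.1 := fun d =>
      Quotient.sound (s := Equiv.Perm.SameCycle.setoid M.rot)
        (firstReturn_sameCycle M.rot M.IsOpeningCorner d).symm
    have steps : ∀ (k : ℕ) (d : M.OpeningDart),
        M.origin ((firstReturn M.rot M.IsOpeningCorner ^ k) d).1 = M.origin d.1 := by
      intro k
      induction k with
      | zero => intro d; rfl
      | succ k ih =>
        intro d
        rw [pow_succ']
        exact (step _).trans (ih d)
    intro a b hab
    obtain ⟨k, -, -, hk⟩ := Equiv.Perm.SameCycle.exists_pow_eq'' (show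
      (firstReturn M.rot M.IsOpeningCorner).SameCycle a b from hab)
    rw [← hk]
    exact (steps k a).symm)

/-- The opening of a pointed drawing: every vertex is labeled by its distance to the basepoint. -/
noncomputable def opening : LabeledDrawing.{u} where
  toRotationSystem := M.openingDrawing
  label v := (M.distLabel (M.openingVertex v) : ℤ)

end PointedDrawing

namespace LabeledDrawing

variable (T : LabeledDrawing.{u})

/-- Labels differ by at most one along every edge, and the labels that occur are exactly
`1, 2, …, m` for some `m ≥ 1`. -/
def IsWellLabeled : Prop :=
  (∀ d : T.Dart, |T.label (T.origin d) - T.label (T.origin (T.opp d))| ≤ 1) ∧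
    ∃ m : ℤ, 1 ≤ m ∧ Set.range T.label = Set.Icc 1 m

/-- Well labeled `g`-trees (maps of genus `g` with one face) with `n` edges, `i` of whose vertices
have odd labels. -/
def IsWellLabeledTree (g n i : ℕ) : Prop :=
  T.IsMapOfGenus g ∧ Nat.card T.Face = 1 ∧ T.IsWellLabeled ∧
    Nat.card T.Edge = n ∧ Nat.card {v : T.Vertex // Odd (T.label v)} = i

end LabeledDrawing

/-- Pointed bipartite quadrangulations of genus `g` with `n` faces and `i` vertices at odd distance
of the basepoint, up to orientation-preserving isomorphism. -/
def PointedBipartiteQuadrangulation (g n i : ℕ) : Type (u + 1) :=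
  Quotient (Setoid.comap (Subtype.val : {M : PointedDrawing.{u} //
    M.IsBipartiteQuadrangulation g n i} → PointedDrawing.{u})
    ⟨PointedDrawing.Equivalent, PointedDrawing.equivalent_equivalence⟩)

/-- Well labeled `g`-trees with `n` edges and `i` vertices with odd labels, up to
orientation-preserving isomorphism. -/
def WellLabeledTree (g n i : ℕ) : Type (u + 1) :=
  Quotient (Setoid.comap (Subtype.val : {T : LabeledDrawing.{u} //
    T.IsWellLabeledTree g n i} → LabeledDrawing.{u})
    ⟨LabeledDrawing.Equivalent, LabeledDrawing.equivalent_equivalence⟩)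

/-- The isomorphism class of a pointed bipartite quadrangulation. -/
def PointedBipartiteQuadrangulation.mk {g n i : ℕ} (M : PointedDrawing.{u})
    (h : M.IsBipartiteQuadrangulation g n i) : PointedBipartiteQuadrangulation.{u} g n i :=
  Quotient.mk _ ⟨M, h⟩

/-- The isomorphism class of a well labeled `g`-tree. -/
def WellLabeledTree.mk {g n i : ℕ} (T : LabeledDrawing.{u})
    (h : T.IsWellLabeledTree g n i) : WellLabeledTree.{u} g n i :=
  Quotient.mk _ ⟨T, h⟩

/-! Distances change by exactly one along each edge of a pointed bipartite quadrangulation `M`, so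
each edge has one downward arc. The rising corners are those immediately counterclockwise of a
downward arc. Hence an arc `o` of the opening corresponds to one edge of `M`, with arcs `dn o` and
`up o`.

Around a face the two upward and two downward steps are either alternating or grouped. Reading both
patterns expresses the rotation of `M` through the labels and the face tour of the opening alone:
`dn o` leads from its corner to the next corner of the tour with smaller label, or to the basepoint.
This is `IsClosure`, proved in `isClosure_opening`; its core, `jump_of_rot_up_eq_up`, is a
descending induction on the label. As these rules determine the rotation (`IsClosure.exists_iso`),
the opening is injective on isomorphism classes.

The opening has one face (`sameCycle_opening`): every corner shares its face with one of label 1,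
and all corners of label 1 are linked by turning around the basepoint. Opening turns V vertices, 2n
edges and n faces into V - 1, n and 1, so the genus is kept.

Conversely, for a well labeled tree `T` the same rules define a permutation, hence a drawing
`closure`. Its faces have degree 4 (`faceNext_four_up`), the labels are its distances
(`lam_closure`), and its opening is `T` (`opening_closure`), which gives surjectivity. -/

/-! ### First returns of a permutation. -/

theorem firstReturn_spec {α : Type u} [Finite α] (f : Equiv.Perm α) (p : α → Prop)
    (x : {x : α // p x}) :
    ∃ k : ℕ, (f ^ (k + 1)) x.1 = (firstReturn f p x).1 ∧ ∀ i < k, ¬ p ((f ^ (i + 1)) x.1) := by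
  classical
  refine ⟨Nat.find (exists_return f p x), ?_, fun i hi => Nat.find_min _ hi⟩
  simp only [firstReturn, nextReturn, Equiv.ofBijective_apply]

theorem firstReturn_eq {α : Type u} [Finite α] (f : Equiv.Perm α) (p : α → Prop)
    (x y : {x : α // p x}) (k : ℕ) (hk : (f ^ (k + 1)) x.1 = y.1)
    (hlt : ∀ i < k, ¬ p ((f ^ (i + 1)) x.1)) : firstReturn f p x = y := by
  obtain ⟨l, hl, hl'⟩ := firstReturn_spec f p x
  apply Subtype.ext
  rcases lt_trichotomy k l with h | h | h
  · exact absurd (hk ▸ y.2) (hl' k h)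
  · rw [← hl, ← h, hk]
  · exact absurd (hl ▸ (firstReturn f p x).2) (hlt l h)

/-- A first return never jumps over an element of `p`, so iterating it meets `y`. This makes
`openingVertex` injective. -/
theorem sameCycle_firstReturn {α : Type u} [Finite α] (f : Equiv.Perm α) (p : α → Prop)
    (x y : {x : α // p x}) (h : f.SameCycle x.1 y.1) : (firstReturn f p).SameCycle x y := by
  obtain ⟨k, hk⟩ := h.exists_nat_pow_eq
  clear h
  induction k using Nat.strong_induction_on generalizing x with
  | _ k ih =>
    obtain ⟨l, hl, hl'⟩ := firstReturn_spec f p x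
    rcases Nat.eq_zero_or_pos k with rfl | hpos
    · rw [Subtype.ext (show x.1 = y.1 from hk)]
    · have hlk : l + 1 ≤ k := by
        by_contra hlt
        refine hl' (k - 1) (by omega) ?_
        rw [Nat.sub_add_cancel hpos, hk]
        exact y.2
      obtain ⟨j, rfl⟩ := Nat.exists_eq_add_of_le hlk
      rw [add_comm, pow_add, Equiv.Perm.mul_apply, hl] at hk
      exact (show (firstReturn f p).SameCycle x (firstReturn f p x) by
        simp [Equiv.Perm.SameCycle.refl]).trans (ih j (by omega) _ hk)

theorem semiconj_pow {α β : Type*} {f : Equiv.Perm α} {g : Equiv.Perm β} {e : α → β}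
    (h : ∀ x, e (f x) = g (e x)) (k : ℕ) (x : α) : e ((f ^ k) x) = (g ^ k) (e x) := by
  induction k with
  | zero => rfl
  | succ k ih => rw [pow_succ', pow_succ', Equiv.Perm.mul_apply, Equiv.Perm.mul_apply, h, ih]

theorem firstReturn_conj {α β : Type u} [Finite α] [Finite β] {f : Equiv.Perm α}
    {g : Equiv.Perm β} {p : α → Prop} {q : β → Prop} (e : α → β) (h : ∀ x, e (f x) = g (e x))
    (hpq : ∀ x, p x ↔ q (e x)) (x : {x : α // p x}) :
    firstReturn g q ⟨e x.1, (hpq _).1 x.2⟩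
      = ⟨e (firstReturn f p x).1, (hpq _).1 (firstReturn f p x).2⟩ := by
  obtain ⟨k, hk, hk'⟩ := firstReturn_spec f p x
  refine firstReturn_eq g q _ _ k ?_ fun i hi => ?_
  · exact (semiconj_pow h _ _).symm.trans (congrArg e hk)
  · rw [← semiconj_pow h, ← hpq]
    exact hk' i hi

theorem card_eq_card_mul_of_fiber {α β : Type*} [Finite α] [Finite β] (f : α → β) (k : ℕ)
    (h : ∀ b, Nat.card {a // f a = b} = k) : Nat.card α = Nat.card β * k := by
  classical
  have := Fintype.ofFinite α
  have := Fintype.ofFinite β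
  rw [Nat.card_congr (Equiv.sigmaFiberEquiv f).symm, Nat.card_sigma,
    Finset.sum_congr rfl fun b _ => h b]
  simp

/-! ### Vertices, faces, isomorphisms and distances of drawings. -/

namespace RotationSystem

variable {M N : RotationSystem.{u}}

instance : Finite M.Vertex := inferInstanceAs (Finite (Quotient _))
instance : Finite M.Face := inferInstanceAs (Finite (Quotient _))

theorem origin_eq_iff {d e : M.Dart} : M.origin d = M.origin e ↔ M.rot.SameCycle d e :=
  Quotient.eq (r := Equiv.Perm.SameCycle.setoid M.rot)

theorem rightFace_eq_iff {d e : M.Dart} :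
    M.rightFace d = M.rightFace e ↔ M.faceNext.SameCycle d e :=
  Quotient.eq (r := Equiv.Perm.SameCycle.setoid M.faceNext)

theorem exists_origin_eq (v : M.Vertex) : ∃ d, M.origin d = v := Quotient.exists_rep v

theorem exists_rightFace_eq (v : M.Face) : ∃ d, M.rightFace d = v := Quotient.exists_rep v

@[simp] theorem origin_rot (d : M.Dart) : M.origin (M.rot d) = M.origin d :=
  origin_eq_iff.2 (by simp [Equiv.Perm.SameCycle.refl])

@[simp] theorem rightFace_faceNext (d : M.Dart) :
    M.rightFace (M.faceNext d) = M.rightFace d :=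
  rightFace_eq_iff.2 (by simp [Equiv.Perm.SameCycle.refl])

theorem faceNext_apply (d : M.Dart) : M.faceNext d = M.rot (M.opp d) := rfl

attribute [simp] opp_opp

theorem origin_rot_pow (k : ℕ) (d : M.Dart) : M.origin ((M.rot ^ k) d) = M.origin d :=
  origin_eq_iff.2 (by simp [Equiv.Perm.SameCycle.refl])

theorem card_dart_eq_two_mul_card_edge : Nat.card M.Dart = Nat.card M.Edge * 2 := by
  refine card_eq_card_mul_of_fiber
    (fun d => (Quotient.mk (Equiv.Perm.SameCycle.setoid M.opp) d : M.Edge)) 2 fun b => ?_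
  obtain ⟨d, rfl⟩ := Quotient.exists_rep b
  have hs : {a | (Quotient.mk (Equiv.Perm.SameCycle.setoid M.opp) a : M.Edge)
      = Quotient.mk (Equiv.Perm.SameCycle.setoid M.opp) d} = {d, M.opp d} := by
    ext a
    rw [Set.mem_ofPred_eq, Quotient.eq (r := Equiv.Perm.SameCycle.setoid M.opp)]
    constructor
    · intro h
      obtain ⟨k, rfl⟩ := (show M.opp.SameCycle a d from h).symm.exists_nat_pow_eq
      induction k with
      | zero => simp
      | succ k ih =>
        have := ih (by
          change M.opp.SameCycle _ _
          simp [Equiv.Perm.SameCycle.refl])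
        rw [pow_succ', Equiv.Perm.mul_apply]
        rcases this with h | h <;> rw [h] <;> simp
    · rintro (rfl | rfl)
      · exact Equiv.Perm.SameCycle.refl _ _
      · change M.opp.SameCycle _ _
        simp [Equiv.Perm.SameCycle.refl]
  have : Nat.card {a | (Quotient.mk (Equiv.Perm.SameCycle.setoid M.opp) a : M.Edge)
      = Quotient.mk (Equiv.Perm.SameCycle.setoid M.opp) d} = 2 := by
    rw [hs, Nat.card_coe_set_eq, Set.ncard_pair (M.opp_ne d).symm]
  exact this

theorem card_dart_of_isQuadrangular (h : M.IsQuadrangular) :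
    Nat.card M.Dart = Nat.card M.Face * 4 :=
  card_eq_card_mul_of_fiber M.rightFace 4 h

/-- The darts along the border of a face. -/
theorem faceDart_eq_image (d : M.Dart) :
    {e | M.rightFace e = M.rightFace d}
      = (fun i => (M.faceNext ^ i) d) '' Set.Iio (Function.minimalPeriod M.faceNext d) := by
  ext e
  have hpos : 0 < Function.minimalPeriod M.faceNext d := by
    apply Function.minimalPeriod_pos_of_mem_periodicPts
    exact ⟨orderOf M.faceNext, orderOf_pos _, by
      rw [Function.IsPeriodicPt, ← Equiv.Perm.coe_pow, pow_orderOf_eq_one]; rfl⟩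
  simp only [Set.mem_ofPred_eq, rightFace_eq_iff, Set.mem_image, Set.mem_Iio]
  constructor
  · intro h
    obtain ⟨k, rfl⟩ := h.symm.exists_nat_pow_eq
    refine ⟨k % Function.minimalPeriod M.faceNext d, Nat.mod_lt _ hpos, ?_⟩
    rw [Equiv.Perm.coe_pow, Equiv.Perm.coe_pow, Function.iterate_mod_minimalPeriod_eq]
  · rintro ⟨k, -, rfl⟩
    simp [Equiv.Perm.SameCycle.refl]

theorem faceDegree_eq_minimalPeriod (d : M.Dart) :
    M.faceDegree (M.rightFace d) = Function.minimalPeriod M.faceNext d := by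
  have : M.faceDegree (M.rightFace d) = {e | M.rightFace e = M.rightFace d}.ncard :=
    Nat.card_coe_set_eq _
  rw [this, faceDart_eq_image, Set.InjOn.ncard_image, Set.ncard_eq_toFinset_card']
  · simp
  · intro i hi j hj h
    simp only [Equiv.Perm.coe_pow] at h
    exact Function.iterate_injOn_Iio_minimalPeriod hi hj h

theorem rightFace_eq_iff_of_isQuadrangular (h : M.IsQuadrangular) {d e : M.Dart} :
    M.rightFace e = M.rightFace d ↔ e = d ∨ e = M.faceNext d ∨ e = M.faceNext (M.faceNext d) ∨
      e = M.faceNext (M.faceNext (M.faceNext d)) := by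
  have h4 := h (M.rightFace d)
  rw [faceDegree_eq_minimalPeriod] at h4
  have := Set.ext_iff.1 (faceDart_eq_image d) e
  rw [h4] at this
  refine this.trans ⟨?_, ?_⟩
  · rintro ⟨i, hi, rfl⟩
    have : i < 4 := hi
    interval_cases i <;> simp [pow_succ]
  · rintro (rfl | rfl | rfl | rfl)
    exacts [⟨0, by simp, rfl⟩, ⟨1, by simp, rfl⟩, ⟨2, by simp, rfl⟩, ⟨3, by simp, rfl⟩]

theorem faceNext_four (h : M.IsQuadrangular) (d : M.Dart) :
    M.faceNext (M.faceNext (M.faceNext (M.faceNext d))) = d := by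
  have h4 := h (M.rightFace d)
  rw [faceDegree_eq_minimalPeriod] at h4
  have := Function.iterate_minimalPeriod (f := M.faceNext) (x := d)
  rwa [h4] at this

theorem faceNext_two_ne (h : M.IsQuadrangular) (d : M.Dart) :
    M.faceNext (M.faceNext d) ≠ d := by
  have h4 := h (M.rightFace d)
  rw [faceDegree_eq_minimalPeriod] at h4
  intro h2
  have : Function.IsPeriodicPt M.faceNext 2 d := h2
  have := this.minimalPeriod_le (by norm_num)
  omega

theorem Iso.origin_eq_iff (e : Iso M N) {a b : M.Dart} :
    N.origin (e.toEquiv a) = N.origin (e.toEquiv b) ↔ M.origin a = M.origin b := by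
  have key : ∀ {M N : RotationSystem.{u}} (e : Iso M N) {a b : M.Dart},
      M.origin a = M.origin b → N.origin (e.toEquiv a) = N.origin (e.toEquiv b) := by
    intro M N e a b h
    obtain ⟨k, rfl⟩ := (RotationSystem.origin_eq_iff.1 h).exists_nat_pow_eq
    rw [semiconj_pow e.map_rot, origin_rot_pow]
  refine ⟨fun h => ?_, key e⟩
  have := key e.symm h
  simpa [Iso.symm] using this

theorem Iso.map_faceNext (e : Iso M N) (a : M.Dart) :
    e.toEquiv (M.faceNext a) = N.faceNext (e.toEquiv a) := by
  rw [faceNext_apply, e.map_rot, e.map_opp, faceNext_apply]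

theorem Iso.rightFace_eq_iff (e : Iso M N) {a b : M.Dart} :
    N.rightFace (e.toEquiv a) = N.rightFace (e.toEquiv b) ↔ M.rightFace a = M.rightFace b := by
  have key : ∀ {M N : RotationSystem.{u}} (e : Iso M N) {a b : M.Dart},
      M.rightFace a = M.rightFace b → N.rightFace (e.toEquiv a) = N.rightFace (e.toEquiv b) := by
    intro M N e a b h
    obtain ⟨k, rfl⟩ := (RotationSystem.rightFace_eq_iff.1 h).exists_nat_pow_eq
    rw [semiconj_pow e.map_faceNext, RotationSystem.rightFace_eq_iff]
    simp [Equiv.Perm.SameCycle.refl]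
  refine ⟨fun h => ?_, key e⟩
  have := key e.symm h
  simpa [Iso.symm] using this

/-- The bijection between the vertices induced by an isomorphism. -/
def Iso.vertexEquiv (e : Iso M N) : M.Vertex ≃ N.Vertex :=
  Quotient.congr (ra := Equiv.Perm.SameCycle.setoid M.rot)
    (rb := Equiv.Perm.SameCycle.setoid N.rot) e.toEquiv fun _ _ =>
    RotationSystem.origin_eq_iff.symm.trans (e.origin_eq_iff.symm.trans RotationSystem.origin_eq_iff)

@[simp] theorem Iso.vertexEquiv_origin (e : Iso M N) (d : M.Dart) :
    e.vertexEquiv (M.origin d) = N.origin (e.toEquiv d) := rfl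

theorem graph_adj_of_ne (d : M.Dart) (h : M.origin d ≠ M.origin (M.opp d)) :
    M.graph.Adj (M.origin d) (M.origin (M.opp d)) :=
  (SimpleGraph.fromRel_adj _ _ _).2 ⟨h, Or.inl ⟨d, rfl, rfl⟩⟩

theorem exists_dart_of_adj {v w : M.Vertex} (h : M.graph.Adj v w) :
    ∃ d, M.origin d = v ∧ M.origin (M.opp d) = w := by
  obtain ⟨-, ⟨d, h1, h2⟩ | ⟨d, h1, h2⟩⟩ := (SimpleGraph.fromRel_adj _ _ _).1 h
  · exact ⟨d, h1, h2⟩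
  · exact ⟨M.opp d, h2, by simpa using h1⟩

theorem reachable_opp (d : M.Dart) : M.graph.Reachable (M.origin d) (M.origin (M.opp d)) := by
  by_cases h : M.origin d = M.origin (M.opp d)
  · rw [← h]
  · exact (graph_adj_of_ne d h).reachable

theorem graph_connected (h : M.IsMap) : M.graph.Connected := by
  have : Nonempty M.Vertex := h.1.map M.origin
  refine ⟨fun v w => ?_⟩
  obtain ⟨d, rfl⟩ := exists_origin_eq v
  obtain ⟨e, rfl⟩ := exists_origin_eq w
  obtain ⟨p, hp, rfl⟩ := h.2 d e
  induction hp using Subgroup.closure_induction generalizing d with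
  | mem x hx =>
    rcases hx with rfl | rfl
    · simp
    · exact reachable_opp d
  | one => simp
  | mul x y _ _ hx hy => exact (hy d).trans (hx (y d))
  | inv x _ hx =>
    have := hx (x⁻¹ d)
    simpa using this.symm

/-- A function on the vertices that vanishes at `b` only, varies by at most one along the edges and
can be decreased from every other vertex is the distance to `b`. -/
theorem dist_eq_of_descent (b : M.Vertex) (f : M.Vertex → ℕ) (hb : f b = 0)
    (hstep : ∀ d, f (M.origin (M.opp d)) ≤ f (M.origin d) + 1)
    (hdesc : ∀ v, v ≠ b → ∃ d, M.origin d = v ∧ f (M.origin (M.opp d)) + 1 = f v)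
    (v : M.Vertex) : M.graph.dist b v = f v := by
  have hle : ∀ {v w : M.Vertex} (p : M.graph.Walk v w), f w ≤ f v + p.length := by
    intro v w p
    induction p with
    | nil => simp
    | cons h p ih =>
      obtain ⟨d, rfl, rfl⟩ := exists_dart_of_adj h
      have := hstep d
      rw [SimpleGraph.Walk.length_cons]
      omega
  have hwalk : ∀ n v, f v = n → ∃ p : M.graph.Walk b v, p.length = n := by
    intro n
    induction n with
    | zero =>
      intro v hv
      by_cases hvb : v = b
      · subst hvb; exact ⟨.nil, rfl⟩
      · obtain ⟨d, -, h⟩ := hdesc v hvb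
        omega
    | succ n ih =>
      intro v hv
      obtain ⟨d, rfl, h⟩ := hdesc v (by rintro rfl; omega)
      obtain ⟨p, hp⟩ := ih (M.origin (M.opp d)) (by omega)
      have hadj : M.graph.Adj (M.origin (M.opp d)) (M.origin d) :=
        (graph_adj_of_ne d (fun h' => by rw [← h'] at h; omega)).symm
      exact ⟨p.concat hadj, by rw [SimpleGraph.Walk.length_concat, hp]⟩
  obtain ⟨p, hp⟩ := hwalk _ v rfl
  apply le_antisymm
  · rw [← hp]; exact SimpleGraph.dist_le p
  · obtain ⟨q, hq⟩ := p.reachable.exists_walk_length_eq_dist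
    have := hle q
    omega

/-- In a one-face drawing every dart is reached from every other along the face. -/
theorem sameCycle_faceNext_of_card_face (h : Nat.card M.Face = 1) (d e : M.Dart) :
    M.faceNext.SameCycle d e := by
  have := (Nat.card_eq_one_iff_unique.1 h).1
  exact rightFace_eq_iff.1 (Subsingleton.elim _ _)

theorem faceNext_mem_closure :
    M.faceNext ∈ Subgroup.closure ({M.rot, M.opp} : Set (Equiv.Perm M.Dart)) :=
  mul_mem (Subgroup.subset_closure (by simp)) (Subgroup.subset_closure (by simp))

theorem isMap_of_sameCycle_faceNext [Nonempty M.Dart]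
    (h : ∀ d e, M.faceNext.SameCycle d e) : M.IsMap := by
  refine ⟨inferInstance, fun d e => ?_⟩
  obtain ⟨k, hk⟩ := h d e
  exact ⟨_, zpow_mem faceNext_mem_closure k, hk⟩

end RotationSystem

/-- The label of the origin of a dart. -/
def LabeledDrawing.lab (T : LabeledDrawing.{u}) (d : T.Dart) : ℤ := T.label (T.origin d)

@[simp] theorem LabeledDrawing.lab_rot (T : LabeledDrawing.{u}) (d : T.Dart) :
    T.lab (T.rot d) = T.lab d := by
  simp [LabeledDrawing.lab]

theorem LabeledDrawing.lab_faceNext (T : LabeledDrawing.{u}) (d : T.Dart) :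
    T.lab (T.faceNext d) = T.lab (T.opp d) := by
  rw [RotationSystem.faceNext_apply, lab_rot]

/-! ### Labels around the vertices and faces of a pointed quadrangulation. -/

namespace PointedDrawing

/-- Pointed bipartite quadrangulations, of any genus and size. -/
structure IsQuadrangulation (M : PointedDrawing.{u}) : Prop where
  isMap : M.IsMap
  isQuadrangular : M.IsQuadrangular
  isBipartite : M.IsBipartite

variable {M : PointedDrawing.{u}}

/-- The distance of the origin of a dart to the basepoint. -/
noncomputable def lam (M : PointedDrawing.{u}) (d : M.Dart) : ℤ := M.distLabel (M.origin d)

@[simp] theorem lam_rot (d : M.Dart) : M.lam (M.rot d) = M.lam d := by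
  simp [lam]

theorem lam_rot_pow (k : ℕ) (d : M.Dart) : M.lam ((M.rot ^ k) d) = M.lam d := by
  simp [lam, RotationSystem.origin_rot_pow]

theorem lam_rot_inv (d : M.Dart) : M.lam (M.rot⁻¹ d) = M.lam d := by
  conv_rhs => rw [← Equiv.apply_symm_apply M.rot d, lam_rot]
  rfl

theorem lam_faceNext (d : M.Dart) : M.lam (M.faceNext d) = M.lam (M.opp d) := lam_rot _

theorem lam_nonneg (d : M.Dart) : 0 ≤ M.lam d := Int.natCast_nonneg _

/-- Adjacent distances differ by at most one, and the two-colouring fixes the parity of the length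
of a walk from the basepoint, so they cannot be equal. -/
theorem lam_opp (hM : M.IsQuadrangulation) (d : M.Dart) :
    M.lam (M.opp d) = M.lam d - 1 ∨ M.lam (M.opp d) = M.lam d + 1 := by
  obtain ⟨c, hc⟩ := hM.isBipartite
  have hne : M.origin d ≠ M.origin (M.opp d) := fun h => hc d (by rw [← h])
  have hadj := RotationSystem.graph_adj_of_ne d hne
  have hconn := RotationSystem.graph_connected hM.isMap
  let C : M.graph.Coloring Bool := SimpleGraph.Coloring.mk c (by
    intro v w h
    obtain ⟨d, rfl, rfl⟩ := RotationSystem.exists_dart_of_adj h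
    exact hc d)
  obtain ⟨p, hp⟩ := hconn.exists_walk_length_eq_dist M.base (M.origin d)
  obtain ⟨q, hq⟩ := hconn.exists_walk_length_eq_dist M.base (M.origin (M.opp d))
  have h1 := C.even_length_iff_congr p
  have h2 := C.even_length_iff_congr q
  have h3 : C (M.origin d) ≠ C (M.origin (M.opp d)) := hc d
  have hneq : M.graph.dist M.base (M.origin d) ≠ M.graph.dist M.base (M.origin (M.opp d)) := by
    intro h
    rw [hp, h, ← hq, h2] at h1
    revert h1 h3
    cases C (M.origin d) <;> cases C (M.origin (M.opp d)) <;> cases C M.base <;> simp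
  have := hadj.diff_dist_adj (u := M.base)
  simp only [lam, distLabel]
  omega

theorem lam_eq_zero_iff (hM : M.IsQuadrangulation) (d : M.Dart) : M.lam d = 0 ↔ M.origin d = M.base := by
  rw [lam, distLabel, Int.natCast_eq_zero,
    (RotationSystem.graph_connected hM.isMap).dist_eq_zero_iff]
  exact eq_comm

/-- The darts that lead to a vertex closer to the basepoint. -/
def IsDown (M : PointedDrawing.{u}) (d : M.Dart) : Prop := M.lam (M.opp d) = M.lam d - 1

theorem not_isDown_iff (hM : M.IsQuadrangulation) (d : M.Dart) : ¬ M.IsDown d ↔ M.IsDown (M.opp d) := by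
  have := lam_opp hM d
  rw [IsDown, IsDown, M.opp_opp]
  omega

/-- The first step of a geodesic to the basepoint is downward. -/
theorem exists_isDown (hM : M.IsQuadrangulation) (d : M.Dart) (h : M.lam d ≠ 0) :
    ∃ k, M.IsDown ((M.rot ^ k) d) := by
  have hconn := RotationSystem.graph_connected hM.isMap
  obtain ⟨v, hv⟩ : ∃ v, v = M.origin d := ⟨_, rfl⟩
  obtain ⟨b, hb⟩ : ∃ b, b = M.base := ⟨_, rfl⟩
  obtain ⟨p, hp⟩ := hconn.exists_walk_length_eq_dist v b
  cases p with
  | nil => exact absurd ((lam_eq_zero_iff hM d).2 (hv.symm.trans hb)) h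
  | cons hadj p =>
    obtain ⟨e, he, rfl⟩ := RotationSystem.exists_dart_of_adj hadj
    subst hv hb
    obtain ⟨k, rfl⟩ := (RotationSystem.origin_eq_iff.1 he).symm.exists_nat_pow_eq
    refine ⟨k, ?_⟩
    have h1 := SimpleGraph.dist_le p
    rw [SimpleGraph.dist_comm] at h1 hp
    have h2 := lam_opp hM ((M.rot ^ k) d)
    have h3 := lam_rot_pow k d
    rw [SimpleGraph.Walk.length_cons] at hp
    simp only [IsDown, lam, distLabel] at *
    omega

/-- The corner preceding `rot x` in its face is `opp x`, at the other end of `x`. -/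
theorem isRising_rot_iff (hM : M.IsQuadrangulation) (x : M.Dart) : M.IsRising (M.rot x) ↔ M.IsDown x := by
  have h : M.faceNext⁻¹ (M.rot x) = M.opp x := by
    rw [Equiv.Perm.inv_eq_iff_eq, RotationSystem.faceNext_apply, M.opp_opp]
  have h1 : M.IsRising (M.rot x) ↔ M.lam (M.opp x) < M.lam (M.rot x) := by
    rw [IsRising, h, lam, lam]
    exact Int.ofNat_lt.symm
  have := lam_opp hM x
  rw [h1, lam_rot, IsDown]
  omega

theorem isRising_faceNext_iff (hM : M.IsQuadrangulation) (x : M.Dart) :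
    M.IsRising (M.faceNext x) ↔ M.lam (M.faceNext x) = M.lam x + 1 := by
  rw [RotationSystem.faceNext_apply, isRising_rot_iff hM, IsDown, M.opp_opp, lam_rot]
  omega

theorem lam_faceNext_cases (hM : M.IsQuadrangulation) (x : M.Dart) :
    M.lam (M.faceNext x) = M.lam x - 1 ∨ M.lam (M.faceNext x) = M.lam x + 1 := by
  rw [lam_faceNext]
  exact lam_opp hM x

/-- The four steps around the face are ±1 and sum to zero. The step into `d` is +1, so exactly one
of the other three is; the cases say which. -/
theorem ncard_risingCorners (hM : M.IsQuadrangulation) (d : M.Dart) (hd : M.IsRising d) :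
    (M.risingCorners d).ncard = 2 := by
  have hq := hM.isQuadrangular
  have h4 := RotationSystem.faceNext_four hq d
  set d1 := M.faceNext d with hd1
  set d2 := M.faceNext d1 with hd2
  set d3 := M.faceNext d2 with hd3
  have hr0 := isRising_faceNext_iff hM d3
  have hr1 := isRising_faceNext_iff hM d
  have hr2 := isRising_faceNext_iff hM d1
  have hr3 := isRising_faceNext_iff hM d2
  have c1 := lam_faceNext_cases hM d
  have c2 := lam_faceNext_cases hM d1
  have c3 := lam_faceNext_cases hM d2
  have c0 := lam_faceNext_cases hM d3
  rw [← hd1] at hr1 c1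
  rw [← hd2] at hr2 c2
  rw [← hd3] at hr3 c3
  rw [h4] at hr0 c0
  have h2 : d2 ≠ d := RotationSystem.faceNext_two_ne hq d
  have hmem : ∀ e, e ∈ M.risingCorners d ↔ (e = d ∨ e = d1 ∨ e = d2 ∨ e = d3) ∧ M.IsRising e := by
    intro e
    rw [hd3, hd2, hd1, ← RotationSystem.rightFace_eq_iff_of_isQuadrangular hq]
    rfl
  have h0 := hr0.1 hd
  obtain ⟨e, hed, he⟩ : ∃ e, e ≠ d ∧ M.risingCorners d = {d, e} := by
    rcases c1 with c1 | c1
    · rcases c2 with c2 | c2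
      · refine ⟨d3, fun h => by rw [h] at h0; omega, ?_⟩
        ext e
        rw [hmem]
        constructor
        · rintro ⟨rfl | rfl | rfl | rfl, h⟩
          · simp
          · have := hr1.1 h; omega
          · have := hr2.1 h; omega
          · simp
        · rintro (rfl | rfl)
          · exact ⟨Or.inl rfl, hd⟩
          · exact ⟨by simp, hr3.2 (by omega)⟩
      · refine ⟨d2, h2, ?_⟩
        ext e
        rw [hmem]
        constructor
        · rintro ⟨rfl | rfl | rfl | rfl, h⟩
          · simp
          · have := hr1.1 h; omega
          · simp
          · have := hr3.1 h; omega
        · rintro (rfl | rfl)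
          · exact ⟨Or.inl rfl, hd⟩
          · exact ⟨by simp, hr2.2 (by omega)⟩
    · refine ⟨d1, fun h => by rw [h] at c1; omega, ?_⟩
      ext e
      rw [hmem]
      constructor
      · rintro ⟨rfl | rfl | rfl | rfl, h⟩
        · simp
        · simp
        · have := hr2.1 h; omega
        · have := hr3.1 h; omega
      · rintro (rfl | rfl)
        · exact ⟨Or.inl rfl, hd⟩
        · exact ⟨by simp, hr1.2 (by omega)⟩
  rw [he, Set.ncard_pair hed.symm]

theorem isOpeningCorner_rot_iff (hM : M.IsQuadrangulation) (x : M.Dart) :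
    M.IsOpeningCorner (M.rot x) ↔ M.IsDown x :=
  ⟨fun h => (isRising_rot_iff hM x).1 h.1, fun h =>
    have h' := (isRising_rot_iff hM x).2 h
    ⟨h', ncard_risingCorners hM _ h'⟩⟩

/-- The downward dart in the corner in which an arc of the opening starts. -/
def dn (M : PointedDrawing.{u}) (o : M.opening.Dart) : M.Dart := M.rot⁻¹ o.1

/-- The reverse of `dn`. -/
def up (M : PointedDrawing.{u}) (o : M.opening.Dart) : M.Dart := M.opp (M.dn o)

@[simp] theorem rot_dn (o : M.opening.Dart) : M.rot (M.dn o) = o.1 :=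
  Equiv.apply_symm_apply _ _

@[simp] theorem opp_up (o : M.opening.Dart) : M.opp (M.up o) = M.dn o := M.opp_opp _

theorem opp_dn (o : M.opening.Dart) : M.opp (M.dn o) = M.up o := rfl

theorem faceNext_up (o : M.opening.Dart) : M.faceNext (M.up o) = o.1 := by
  rw [RotationSystem.faceNext_apply, opp_up, rot_dn]

theorem faceNext_dn (o : M.opening.Dart) : M.faceNext (M.dn o) = M.rot (M.up o) := rfl

theorem dn_injective : Function.Injective M.dn := fun _ _ h =>
  Subtype.ext (M.rot⁻¹.injective h)

theorem isDown_dn (hM : M.IsQuadrangulation) (o : M.opening.Dart) : M.IsDown (M.dn o) := by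
  rw [← isOpeningCorner_rot_iff hM, rot_dn]
  exact o.2

theorem not_isDown_up (hM : M.IsQuadrangulation) (o : M.opening.Dart) : ¬ M.IsDown (M.up o) := by
  rw [not_isDown_iff hM, opp_up]
  exact isDown_dn hM o

theorem dn_ne_up (hM : M.IsQuadrangulation) (o o' : M.opening.Dart) : M.dn o ≠ M.up o' := fun h =>
  not_isDown_up hM o' (h ▸ isDown_dn hM o)

theorem exists_dn_eq (hM : M.IsQuadrangulation) {d : M.Dart} (hd : M.IsDown d) : ∃ o, M.dn o = d :=
  ⟨⟨M.rot d, (isOpeningCorner_rot_iff hM d).2 hd⟩, Equiv.symm_apply_apply _ _⟩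

theorem exists_dn_or_up (hM : M.IsQuadrangulation) (d : M.Dart) : ∃ o, d = M.dn o ∨ d = M.up o := by
  by_cases h : M.IsDown d
  · obtain ⟨o, rfl⟩ := exists_dn_eq hM h
    exact ⟨o, Or.inl rfl⟩
  · obtain ⟨o, ho⟩ := exists_dn_eq hM ((not_isDown_iff hM d).1 h)
    exact ⟨o, Or.inr (by rw [up, ho, M.opp_opp])⟩

theorem lam_dn (o : M.opening.Dart) : M.lam (M.dn o) = M.opening.lab o := lam_rot_inv _

theorem lam_up (hM : M.IsQuadrangulation) (o : M.opening.Dart) : M.lam (M.up o) = M.opening.lab o - 1 := by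
  rw [← lam_dn]
  exact isDown_dn hM o

/-- The arc `up o` immediately precedes the corner `o` in its face, so the new edge of a face pairs
the two upward arcs on its border. -/
theorem opening_opp_eq {o o' : M.opening.Dart} (hne : M.up o' ≠ M.up o)
    (h : M.rightFace (M.up o') = M.rightFace (M.up o)) : M.opening.opp o = o' := by
  refine M.partner_unique (M.partner_ne o) (M.rightFace_partner o) ?_ ?_
  · rintro rfl; exact hne rfl
  · rw [← faceNext_up, ← faceNext_up, RotationSystem.rightFace_faceNext,
      RotationSystem.rightFace_faceNext, h]

theorem opening_rot_spec (hM : M.IsQuadrangulation) (o : M.opening.Dart) :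
    ∃ k : ℕ, (M.rot ^ (k + 1)) (M.dn o) = M.dn (M.opening.rot o) ∧
      ∀ i < k, ¬ M.IsDown ((M.rot ^ (i + 1)) (M.dn o)) := by
  obtain ⟨k, hk, hk'⟩ := firstReturn_spec M.rot M.IsOpeningCorner o
  refine ⟨k, M.rot.injective ?_, fun i hi => ?_⟩
  · rw [rot_dn, ← Equiv.Perm.mul_apply, ← pow_succ', pow_succ, Equiv.Perm.mul_apply, rot_dn]
    exact hk
  · rw [← isOpeningCorner_rot_iff hM, ← Equiv.Perm.mul_apply, ← pow_succ', pow_succ,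
      Equiv.Perm.mul_apply, rot_dn]
    exact hk' i hi

theorem opening_rot_eq (hM : M.IsQuadrangulation) {o o' : M.opening.Dart} (k : ℕ)
    (hk : (M.rot ^ (k + 1)) (M.dn o) = M.dn o')
    (hlt : ∀ i < k, ¬ M.IsDown ((M.rot ^ (i + 1)) (M.dn o))) : M.opening.rot o = o' := by
  refine firstReturn_eq M.rot M.IsOpeningCorner o o' k ?_ fun i hi => ?_
  · refine ((congrArg M.rot hk.symm).trans ?_).symm.trans (rot_dn o')
    rw [← Equiv.Perm.mul_apply, ← pow_succ', pow_succ, Equiv.Perm.mul_apply, rot_dn]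
  · have := hlt i hi
    rwa [← isOpeningCorner_rot_iff hM, ← Equiv.Perm.mul_apply, ← pow_succ', pow_succ,
      Equiv.Perm.mul_apply, rot_dn] at this

theorem opening_rot_of_rot_dn (hM : M.IsQuadrangulation) {o o' : M.opening.Dart}
    (h : M.rot (M.dn o) = M.dn o') : M.opening.rot o = o' :=
  opening_rot_eq hM 0 (by simpa using h) (by simp)

end PointedDrawing

/-! ### Excursions of the labels along the face tour, and the closure rules. -/

namespace LabeledDrawing

variable {T : LabeledDrawing.{u}}

/-- Following the face from `a` one arrives at `b`, and before that all labels are at least `l`. -/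
def Climbs (T : LabeledDrawing.{u}) (l : ℤ) (a b : T.Dart) : Prop :=
  ∃ k : ℕ, (T.faceNext ^ k) a = b ∧ ∀ i < k, l ≤ T.lab ((T.faceNext ^ i) a)

theorem Climbs.refl (l : ℤ) (a : T.Dart) : T.Climbs l a a := ⟨0, rfl, by simp⟩

theorem Climbs.trans {l : ℤ} {a b c : T.Dart} (h : T.Climbs l a b) (h' : T.Climbs l b c) :
    T.Climbs l a c := by
  obtain ⟨k, rfl, hk⟩ := h
  obtain ⟨m, rfl, hm⟩ := h'
  refine ⟨m + k, by rw [pow_add, Equiv.Perm.mul_apply], fun i hi => ?_⟩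
  by_cases hik : i < k
  · exact hk i hik
  · obtain ⟨j, rfl⟩ := Nat.exists_eq_add_of_le (not_lt.1 hik)
    have := hm j (by omega)
    rwa [← Equiv.Perm.mul_apply, ← pow_add, add_comm] at this

theorem Climbs.mono {l l' : ℤ} (hl : l' ≤ l) {a b : T.Dart} (h : T.Climbs l a b) :
    T.Climbs l' a b := by
  obtain ⟨k, hk, h⟩ := h
  exact ⟨k, hk, fun i hi => hl.trans (h i hi)⟩

theorem Climbs.step {l : ℤ} {a : T.Dart} (h : l ≤ T.lab a) : T.Climbs l a (T.faceNext a) :=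
  ⟨1, by simp, fun i hi => by
    obtain rfl : i = 0 := by omega
    simpa using h⟩

theorem Climbs.sameCycle {l : ℤ} {a b : T.Dart} (h : T.Climbs l a b) :
    T.faceNext.SameCycle a b := by
  obtain ⟨k, rfl, -⟩ := h
  simp [Equiv.Perm.SameCycle.refl]

theorem Climbs.unique {l : ℤ} {a b b' : T.Dart} (h : T.Climbs l a b) (h' : T.Climbs l a b')
    (hb : T.lab b < l) (hb' : T.lab b' < l) : b = b' := by
  obtain ⟨k, rfl, hk⟩ := h
  obtain ⟨m, rfl, hm⟩ := h'
  rcases lt_trichotomy k m with hkm | rfl | hkm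
  · have := hm k hkm; omega
  · rfl
  · have := hk m hkm; omega

/-- `x` is the first corner after `z` along the face whose label is not larger than the one
of `z`, and the two labels are equal. -/
def Jump (T : LabeledDrawing.{u}) (z x : T.Dart) : Prop :=
  T.lab z = T.lab x ∧ T.Climbs (T.lab z + 1) (T.faceNext z) x

theorem Jump.climbs {z x : T.Dart} (h : T.Jump z x) : T.Climbs (T.lab z) z x :=
  (Climbs.step le_rfl).trans (h.2.mono (by omega))

theorem Jump.right_unique {z x x' : T.Dart} (h : T.Jump z x) (h' : T.Jump z x') : x = x' :=
  h.2.unique h'.2 (by have := h.1; omega) (by have := h'.1; omega)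

theorem Jump.le {y z : T.Dart} (h : T.Jump y (T.faceNext z)) : T.lab (T.faceNext z) ≤ T.lab z := by
  obtain ⟨h1, k, hk, hk'⟩ := h
  cases k with
  | zero =>
    obtain rfl := T.faceNext.injective hk
    exact h1.ge
  | succ k =>
    have h2 := hk' k (by omega)
    rw [pow_succ', Equiv.Perm.mul_apply] at hk
    rw [T.faceNext.injective hk] at h2
    omega

/-- Of two excursions ending at `x`, the longer would pass the start of the shorter, whose label is
too small. -/
theorem Jump.left_unique {z z' x : T.Dart} (h : T.Jump z x) (h' : T.Jump z' x) : z = z' := by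
  have key : ∀ {z z' : T.Dart} {k m : ℕ}, T.lab z = T.lab z' →
      (∀ i < m, T.lab z' + 1 ≤ T.lab ((T.faceNext ^ i) (T.faceNext z'))) →
      (T.faceNext ^ k) (T.faceNext z) = (T.faceNext ^ m) (T.faceNext z') → k ≤ m → z = z' := by
    intro z z' k m hz hm hkm hle
    obtain ⟨j, rfl⟩ := Nat.exists_eq_add_of_le hle
    rw [pow_add, Equiv.Perm.mul_apply] at hkm
    have h1 := (T.faceNext ^ k).injective hkm
    cases j with
    | zero => exact T.faceNext.injective h1
    | succ j =>
      rw [pow_succ', Equiv.Perm.mul_apply] at h1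
      have h2 := T.faceNext.injective h1
      have h3 := hm j (by omega)
      rw [← h2] at h3
      omega
  obtain ⟨h1, k, hk, hk'⟩ := h
  obtain ⟨h1', m, hm, hm'⟩ := h'
  rcases le_total k m with hkm | hkm
  · exact key (h1.trans h1'.symm) hm' (hk.trans hm.symm) hkm
  · exact (key (h1'.trans h1.symm) hk' (hm.trans hk.symm) hkm).symm

theorem Jump.map {T' : LabeledDrawing.{u}}
    (e : RotationSystem.Iso T.toRotationSystem T'.toRotationSystem)
    (he : ∀ d, T.lab d = T'.lab (e.toEquiv d)) {z x : T.Dart} (h : T.Jump z x) :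
    T'.Jump (e.toEquiv z) (e.toEquiv x) := by
  obtain ⟨h1, k, rfl, hk⟩ := h
  refine ⟨by rw [← he, ← he, h1], k, ?_, fun i hi => ?_⟩
  · rw [← e.map_faceNext, ← semiconj_pow e.map_faceNext]
  · rw [← e.map_faceNext, ← semiconj_pow e.map_faceNext, ← he, ← he]
    exact hk i hi

/-- `M` arises from `T` by drawing in each corner of `T` an edge, namely `down`, to the next corner
along the face that has a smaller label (or to an additional vertex), and deleting `T`. -/
structure IsClosure (T : LabeledDrawing.{u}) (M : RotationSystem.{u}) (down : T.Dart → M.Dart) :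
    Prop where
  injective : Function.Injective down
  down_ne : ∀ x y, down x ≠ M.opp (down y)
  exists_eq : ∀ d, ∃ x, d = down x ∨ d = M.opp (down x)
  -- Counterclockwise after `down x` comes the corner `rot x`, whose predecessor on the face is `opp
  -- x`. Edges end in that corner only if this predecessor has the larger label, and its own edge is
  -- then the first one met.
  rot_down_up : ∀ x, T.lab (T.opp x) = T.lab x + 1 → M.rot (down x) = M.opp (down (T.opp x))
  rot_down_down : ∀ x, T.lab (T.opp x) ≠ T.lab x + 1 → M.rot (down x) = down (T.rot x)
  -- A smaller label just before `faceNext z` screens off all earlier corners: this is the last edge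
  -- ending in `y`, and `down y` follows.
  rot_up_down : ∀ z, T.lab (T.faceNext z) = T.lab z + 1 →
    ∃ y, T.Jump z y ∧ M.rot (M.opp (down (T.faceNext z))) = down y
  -- Otherwise the next edge with the same end starts at the nearest earlier corner of equal label.
  rot_up_up : ∀ z, T.lab (T.faceNext z) ≠ T.lab z + 1 →
    ∃ y, T.Jump y (T.faceNext z) ∧ M.rot (M.opp (down (T.faceNext z))) = M.opp (down y)

theorem IsClosure.bijective {T : LabeledDrawing.{u}} {M : RotationSystem.{u}}
    {down : T.Dart → M.Dart} (h : T.IsClosure M down) :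
    Function.Bijective (Sum.elim down (fun x => M.opp (down x)) : T.Dart ⊕ T.Dart → M.Dart) := by
  constructor
  · rintro (x | x) (y | y) hxy
    · exact congrArg _ (h.injective hxy)
    · exact absurd hxy (h.down_ne _ _)
    · exact absurd hxy.symm (h.down_ne _ _)
    · exact congrArg _ (h.injective (M.opp.injective hxy))
  · intro d
    obtain ⟨x, rfl | rfl⟩ := h.exists_eq d
    exacts [⟨Sum.inl x, rfl⟩, ⟨Sum.inr x, rfl⟩]

/-- The rotation rules mention only labels and the face tour of the tree, and jumps are unique at
both ends, so the rules transport along `e`. -/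
theorem IsClosure.exists_iso {T T' : LabeledDrawing.{u}} {M M' : RotationSystem.{u}}
    {down : T.Dart → M.Dart} {down' : T'.Dart → M'.Dart} (h : T.IsClosure M down)
    (h' : T'.IsClosure M' down')
    (e : RotationSystem.Iso T.toRotationSystem T'.toRotationSystem)
    (he : ∀ d, T.lab d = T'.lab (e.toEquiv d)) :
    ∃ f : RotationSystem.Iso M M', ∀ x, f.toEquiv (down x) = down' (e.toEquiv x) := by
  let E : M.Dart ≃ M'.Dart := (Equiv.ofBijective _ h.bijective).symm.trans
    ((Equiv.sumCongr e.toEquiv e.toEquiv).trans (Equiv.ofBijective _ h'.bijective))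
  have h1 : ∀ x, E (down x) = down' (e.toEquiv x) := by
    intro x
    have : (Equiv.ofBijective _ h.bijective).symm (down x) = Sum.inl x := by
      rw [Equiv.symm_apply_eq]; rfl
    simp only [E, Equiv.trans_apply, this]
    rfl
  have h2 : ∀ x, E (M.opp (down x)) = M'.opp (down' (e.toEquiv x)) := by
    intro x
    have : (Equiv.ofBijective _ h.bijective).symm (M.opp (down x)) = Sum.inr x := by
      rw [Equiv.symm_apply_eq]; rfl
    simp only [E, Equiv.trans_apply, this]
    rfl
  refine ⟨⟨E, fun d => ?_, fun d => ?_⟩, h1⟩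
  · obtain ⟨x, rfl | rfl⟩ := h.exists_eq d
    · rw [h1]
      by_cases hx : T.lab (T.opp x) = T.lab x + 1
      · rw [h.rot_down_up x hx, h2, e.map_opp, h'.rot_down_up]
        rw [← e.map_opp, ← he, ← he, hx]
      · rw [h.rot_down_down x hx, h1, e.map_rot, h'.rot_down_down]
        rwa [← e.map_opp, ← he, ← he]
    · obtain ⟨z, rfl⟩ := T.faceNext.surjective x
      rw [h2, e.map_faceNext]
      by_cases hz : T.lab (T.faceNext z) = T.lab z + 1
      · obtain ⟨y, hy, hy'⟩ := h.rot_up_down z hz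
        obtain ⟨w, hw, hw'⟩ := h'.rot_up_down (e.toEquiv z)
          (by rwa [← e.map_faceNext, ← he, ← he])
        rw [hy', hw', h1, (hy.map e he).right_unique hw]
      · obtain ⟨y, hy, hy'⟩ := h.rot_up_up z hz
        obtain ⟨w, hw, hw'⟩ := h'.rot_up_up (e.toEquiv z)
          (by rwa [← e.map_faceNext, ← he, ← he])
        rw [← e.map_faceNext] at hw
        rw [hy', hw', h2, (hy.map e he).left_unique hw]
  · obtain ⟨x, rfl | rfl⟩ := h.exists_eq d
    · rw [h1, h2]
    · rw [h2, M.opp_opp, h1, M'.opp_opp]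

end LabeledDrawing

/-! ### A quadrangulation is the closure of its opening, and the opening has one face. -/

namespace PointedDrawing

variable {M : PointedDrawing.{u}}

theorem lam_faceNext_up (o : M.opening.Dart) : M.lam (M.faceNext (M.up o)) = M.opening.lab o := by
  rw [lam_faceNext, opp_up, lam_dn]

theorem lam_faceNext_dn (hM : M.IsQuadrangulation) (o : M.opening.Dart) :
    M.lam (M.faceNext (M.dn o)) = M.opening.lab o - 1 := by
  rw [lam_faceNext, opp_dn, lam_up hM]

theorem rot_dn_eq_faceNext (o : M.opening.Dart) : M.rot (M.dn o) = M.faceNext (M.up o) := by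
  rw [faceNext_up, rot_dn]

theorem opp_of_rot_dn_eq_up (hM : M.IsQuadrangulation) {u w : M.opening.Dart} (h : M.rot (M.dn u) = M.up w) :
    M.opening.opp u = w ∧ M.opening.lab w = M.opening.lab u + 1 := by
  rw [rot_dn_eq_faceNext] at h
  have h1 := lam_faceNext_up u
  rw [h, lam_up hM] at h1
  refine ⟨opening_opp_eq (fun h' => ?_) ?_, by omega⟩
  · have := dn_injective (M.opp.injective h')
    rw [this] at h1
    omega
  · rw [← h, RotationSystem.rightFace_faceNext]

/-- The face through `up u` begins up, down. The remaining steps are up, down (equal labels on the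
new edge) or down, up (the partner is one lower). -/
theorem rot_of_rot_dn_eq_dn (hM : M.IsQuadrangulation) {u y : M.opening.Dart} (h : M.rot (M.dn u) = M.dn y) :
    M.opening.rot u = y ∧ (M.opening.lab (M.opening.opp u) = M.opening.lab u ∨
      M.opening.lab (M.opening.opp u) = M.opening.lab u - 1) := by
  refine ⟨opening_rot_of_rot_dn hM h, ?_⟩
  rw [rot_dn_eq_faceNext] at h
  have h4 := RotationSystem.faceNext_four hM.isQuadrangular (M.up u)
  have h2 := RotationSystem.faceNext_two_ne hM.isQuadrangular (M.up u)
  have hf := RotationSystem.rightFace_faceNext (M := M.toRotationSystem)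
  have l1 := lam_faceNext_up u
  have l0 := lam_up hM u
  have hf1 : M.rightFace (M.faceNext (M.dn y)) = M.rightFace (M.up u) := by rw [← h, hf, hf]
  rw [h] at l1 h4 h2
  rw [lam_dn] at l1
  have l2 := lam_faceNext_dn hM y
  obtain ⟨v, hv | hv⟩ := exists_dn_or_up hM (M.faceNext (M.dn y))
  · rw [hv] at h4 l2 hf1
    rw [lam_dn] at l2
    have l3 := lam_faceNext_dn hM v
    obtain ⟨t, ht | ht⟩ := exists_dn_or_up hM (M.faceNext (M.dn v))
    · rw [ht] at h4
      have := lam_faceNext_dn hM t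
      rw [ht, lam_dn] at l3
      rw [h4] at this
      omega
    · rw [ht, lam_up hM] at l3
      rw [opening_opp_eq (o' := t)]
      · omega
      · intro h'
        have := dn_injective (M.opp.injective h')
        rw [this] at l3
        omega
      · rw [← hf1, ← ht, hf]
  · rw [hv] at h2 hf1 l2
    rw [opening_opp_eq h2 hf1]
    rw [lam_up hM] at l2
    omega

/-- Two consecutive downward steps force the border `dn x`, `dn y`, `up z`, `up w`. The new edge
pairs `z` with `w`, and `rot w = x` in the opening. -/
theorem exists_of_rot_up_eq_dn (hM : M.IsQuadrangulation) {x y : M.opening.Dart}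
    (h : M.rot (M.up x) = M.dn y) :
    ∃ z, M.opening.faceNext z = x ∧ M.opening.lab x = M.opening.lab z + 1 ∧
      M.rot (M.up y) = M.up z := by
  rw [← faceNext_dn] at h
  have h4 := RotationSystem.faceNext_four hM.isQuadrangular (M.dn x)
  have l1 := lam_faceNext_dn hM x
  rw [h] at h4 l1
  rw [lam_dn] at l1
  have l2 := lam_faceNext_dn hM y
  obtain ⟨z, hz | hz⟩ := exists_dn_or_up hM (M.faceNext (M.dn y))
  · rw [hz] at h4 l2
    rw [lam_dn] at l2
    have l3 := lam_faceNext_dn hM z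
    rcases lam_faceNext_cases hM (M.faceNext (M.dn z)) with h | h <;> rw [h4, lam_dn] at h <;> omega
  · refine ⟨z, ?_, ?_, by rw [← faceNext_dn, hz]⟩
    · rw [hz] at h4 l2
      rw [lam_up hM] at l2
      have l3 := lam_faceNext_up z
      obtain ⟨w, hw | hw⟩ := exists_dn_or_up hM (M.faceNext (M.up z))
      · have := lam_faceNext_dn hM w
        rw [hw] at h4 l3
        rw [lam_dn] at l3
        rw [h4, lam_dn] at this
        omega
      · rw [hw] at h4
        rw [RotationSystem.faceNext_apply]
        have := (opp_of_rot_dn_eq_up hM ((rot_dn_eq_faceNext z).trans hw)).1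
        rw [this]
        exact opening_rot_of_rot_dn hM ((rot_dn_eq_faceNext w).trans h4)
    · rw [hz, lam_up hM] at l2
      omega

/-- The border starts with `dn x`, `up z` and continues down, up (first alternative) or up, down
(second). -/
theorem exists_of_rot_up_eq_up (hM : M.IsQuadrangulation) {x z : M.opening.Dart}
    (h : M.rot (M.up x) = M.up z) :
    M.opening.lab z = M.opening.lab x ∧ (M.opening.faceNext z = x ∨
      ∃ w, M.opening.faceNext z = w ∧ M.opening.lab w = M.opening.lab z + 1 ∧
        M.rot (M.up w) = M.dn x) := by
  have h0 := lam_rot (M.up x)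
  rw [h, lam_up hM, lam_up hM] at h0
  refine ⟨by omega, ?_⟩
  rw [← faceNext_dn] at h
  have h4 := RotationSystem.faceNext_four hM.isQuadrangular (M.dn x)
  have h2 := RotationSystem.faceNext_two_ne hM.isQuadrangular (M.up z)
  have hf := RotationSystem.rightFace_faceNext (M := M.toRotationSystem)
  rw [h] at h4
  have l2 := lam_faceNext_up z
  obtain ⟨v, hv | hv⟩ := exists_dn_or_up hM (M.faceNext (M.up z))
  · left
    have hf1 : M.rightFace (M.faceNext (M.dn v)) = M.rightFace (M.up z) := by rw [← hv, hf, hf]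
    rw [hv] at h4 h2 l2
    rw [lam_dn] at l2
    have l3 := lam_faceNext_dn hM v
    obtain ⟨t, ht | ht⟩ := exists_dn_or_up hM (M.faceNext (M.dn v))
    · rw [ht] at h4 l3
      have := lam_faceNext_dn hM t
      rw [h4, lam_dn] at this
      rw [lam_dn] at l3
      omega
    · rw [ht] at h4 h2 hf1
      rw [RotationSystem.faceNext_apply]
      rw [opening_opp_eq h2 hf1]
      exact opening_rot_of_rot_dn hM ((rot_dn_eq_faceNext t).trans h4)
  · right
    obtain ⟨h1, h1'⟩ := opp_of_rot_dn_eq_up hM ((rot_dn_eq_faceNext z).trans hv)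
    rw [hv] at h4
    have l3 := lam_faceNext_up v
    obtain ⟨w, hw | hw⟩ := exists_dn_or_up hM (M.faceNext (M.up v))
    · rw [hw] at h4 l3
      refine ⟨w, ?_, ?_, h4⟩
      · rw [RotationSystem.faceNext_apply, h1]
        exact opening_rot_of_rot_dn hM ((rot_dn_eq_faceNext v).trans hw)
      · rw [lam_dn] at l3
        omega
    · rw [hw] at h4 l3
      have := lam_faceNext_up w
      rw [h4, lam_dn] at this
      rw [lam_up hM] at l3
      omega

/-- Between `dn u` and `dn (rot u)`, where `x = rot u`, lie only upward arcs, the last being `up w`.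
The first belongs to `opp u`, whose successor on the face is `x`; by `H` each later one jumps to the
one before it. Concatenation leads from `w` to `x`. -/
theorem climbs_of_rot_up_eq_dn (hM : M.IsQuadrangulation) {w x : M.opening.Dart}
    (H : ∀ v z, M.opening.lab v = M.opening.lab w → M.rot (M.up v) = M.up z → M.opening.Jump z v)
    (h : M.rot (M.up w) = M.dn x) : M.opening.Climbs (M.opening.lab w) w x := by
  obtain ⟨u, rfl⟩ := M.opening.rot.surjective x
  obtain ⟨k, hk, hk'⟩ := opening_rot_spec hM u
  have hw := lam_rot (M.up w)
  rw [h, lam_up hM, lam_dn, M.opening.lab_rot] at hw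
  have key : ∀ i < k, ∃ v, (M.rot ^ (i + 1)) (M.dn u) = M.up v ∧
      M.opening.lab v = M.opening.lab w ∧
      M.opening.Climbs (M.opening.lab w) v (M.opening.rot u) := by
    intro i
    induction i with
    | zero =>
      intro hi
      have hnd := hk' 0 hi
      obtain ⟨v, hv | hv⟩ := exists_dn_or_up hM ((M.rot ^ (0 + 1)) (M.dn u))
      · rw [hv] at hnd
        exact absurd (isDown_dn hM v) hnd
      · refine ⟨v, hv, ?_⟩
        obtain ⟨h1, h2⟩ := opp_of_rot_dn_eq_up hM (by simpa using hv)
        have h3 : M.opening.lab v = M.opening.lab w := by omega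
        refine ⟨h3, ?_⟩
        have := LabeledDrawing.Climbs.step h3.ge
        rwa [RotationSystem.faceNext_apply, ← h1, M.opening.opp_opp, h1] at this
    | succ i ih =>
      intro hi
      obtain ⟨v, hv, hvl, hvc⟩ := ih (by omega)
      have hnd := hk' _ hi
      obtain ⟨t, ht | ht⟩ := exists_dn_or_up hM ((M.rot ^ (i + 1 + 1)) (M.dn u))
      · rw [ht] at hnd
        exact absurd (isDown_dn hM t) hnd
      · refine ⟨t, ht, ?_⟩
        rw [pow_succ', Equiv.Perm.mul_apply, hv] at ht
        have hj := H v t hvl ht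
        have h3 := hj.1.trans hvl
        have := hj.climbs
        rw [h3] at this
        exact ⟨h3, this.trans hvc⟩
  cases k with
  | zero =>
    rw [← h] at hk
    exact absurd (M.rot.injective (by simpa using hk)) (dn_ne_up hM _ _)
  | succ k =>
    obtain ⟨v, hv, hvl, hvc⟩ := key k (by omega)
    rw [pow_succ', Equiv.Perm.mul_apply, hv, ← h] at hk
    have := dn_injective (M.opp.injective (M.rot.injective hk))
    rwa [this] at hvc

/-- If `faceNext z` is not already `x`, it has the next higher label, and its climb to `x` is made
of jumps at that higher level. Hence the induction descends from the maximal label. -/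
theorem jump_of_rot_up_eq_up (hM : M.IsQuadrangulation) {x z : M.opening.Dart}
    (h : M.rot (M.up x) = M.up z) : M.opening.Jump z x := by
  obtain ⟨B, hB⟩ : ∃ B, ∀ o, M.opening.lab o ≤ B := by
    obtain ⟨B, hB⟩ := (Set.finite_range M.opening.lab).bddAbove
    exact ⟨B, fun o => hB ⟨o, rfl⟩⟩
  -- At `n = 0` the bound contradicts the choice of `B`.
  have key : ∀ n : ℕ, ∀ x z, B < M.opening.lab x + n → M.rot (M.up x) = M.up z →
      M.opening.Jump z x := by
    intro n
    induction n with
    | zero => intro x z hx; have := hB x; simp at hx; omega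
    | succ n ih =>
      intro x z hx h
      obtain ⟨h1, h2 | ⟨w, rfl, hw, hw'⟩⟩ := exists_of_rot_up_eq_up hM h
      · exact ⟨h1, h2 ▸ .refl _ _⟩
      · refine ⟨h1, ?_⟩
        rw [← hw]
        exact climbs_of_rot_up_eq_dn hM (fun v t hv => ih v t (by push_cast at hx; omega)) hw'
  exact key (B + 1 - M.opening.lab x).toNat x z (by omega) h

theorem isClosure_opening (hM : M.IsQuadrangulation) : M.opening.IsClosure M.toRotationSystem M.dn where
  injective := dn_injective
  down_ne := dn_ne_up hM
  exists_eq := exists_dn_or_up hM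
  rot_down_up x hx := by
    obtain ⟨y, h | h⟩ := exists_dn_or_up hM (M.rot (M.dn x))
    · have := (rot_of_rot_dn_eq_dn hM h).2
      omega
    · rw [h, (opp_of_rot_dn_eq_up hM h).1, up]
  rot_down_down x hx := by
    obtain ⟨y, h | h⟩ := exists_dn_or_up hM (M.rot (M.dn x))
    · rw [h, (rot_of_rot_dn_eq_dn hM h).1]
    · obtain ⟨h1, h2⟩ := opp_of_rot_dn_eq_up hM h
      rw [h1] at hx
      exact absurd h2 hx
  rot_up_down z hz := by
    obtain ⟨y, h | h⟩ := exists_dn_or_up hM (M.rot (M.up (M.opening.faceNext z)))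
    · obtain ⟨w, h1, h2, h3⟩ := exists_of_rot_up_eq_dn hM h
      rw [M.opening.faceNext.injective h1] at h3
      exact ⟨y, jump_of_rot_up_eq_up hM h3, h⟩
    · have := (jump_of_rot_up_eq_up hM h).le
      omega
  rot_up_up z hz := by
    obtain ⟨y, h | h⟩ := exists_dn_or_up hM (M.rot (M.up (M.opening.faceNext z)))
    · obtain ⟨w, h1, h2, h3⟩ := exists_of_rot_up_eq_dn hM h
      rw [M.opening.faceNext.injective h1] at h2
      exact absurd h2 hz
    · exact ⟨y, jump_of_rot_up_eq_up hM h, h⟩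

theorem sameCycle_opening_of_rot_pow (hM : M.IsQuadrangulation) {x y : M.opening.Dart} (k : ℕ)
    (h : (M.rot ^ k) (M.up x) = M.up y) (hlt : ∀ i < k, ¬ M.IsDown ((M.rot ^ i) (M.up x))) :
    M.opening.faceNext.SameCycle x y := by
  induction k generalizing y with
  | zero => rw [dn_injective (M.opp.injective h)]
  | succ k ih =>
    have hnd := hlt k (by omega)
    obtain ⟨z, hz | hz⟩ := exists_dn_or_up hM ((M.rot ^ k) (M.up x))
    · rw [hz] at hnd
      exact absurd (isDown_dn hM z) hnd
    · rw [pow_succ', Equiv.Perm.mul_apply, hz] at h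
      exact (ih hz fun i hi => hlt i (by omega)).trans
        (jump_of_rot_up_eq_up hM h).climbs.sameCycle.symm

theorem one_le_lab_opening (hM : M.IsQuadrangulation) (o : M.opening.Dart) : 1 ≤ M.opening.lab o := by
  have h1 := lam_up hM o
  have h2 := lam_nonneg (M.up o)
  omega

/-- The lower end of `up x` is not the basepoint, so turning around it reaches a downward arc `dn
y`. The upward arcs passed on the way are linked by jumps, and one more jump leads to `y`. -/
theorem exists_sameCycle_opening (hM : M.IsQuadrangulation) (x : M.opening.Dart) (hx : M.opening.lab x ≠ 1) :
    ∃ y, M.opening.faceNext.SameCycle x y ∧ M.opening.lab y + 1 = M.opening.lab x := by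
  classical
  have hl := lam_up hM x
  have hex := exists_isDown hM (M.up x) (by omega)
  have hk := Nat.find_spec hex
  have hmin := fun i (hi : i < Nat.find hex) => Nat.find_min hex hi
  generalize Nat.find hex = k at hk hmin
  obtain ⟨y, hy⟩ := exists_dn_eq hM hk
  have hly := lam_rot_pow k (M.up x)
  rw [← hy, lam_dn] at hly
  refine ⟨y, ?_, by omega⟩
  cases k with
  | zero => exact absurd hy (dn_ne_up hM _ _)
  | succ k =>
    obtain ⟨z, hz | hz⟩ := exists_dn_or_up hM ((M.rot ^ k) (M.up x))
    · have := hmin k (by omega)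
      rw [hz] at this
      exact absurd (isDown_dn hM z) this
    · have h1 := sameCycle_opening_of_rot_pow hM k hz fun i hi => hmin i (by omega)
      rw [pow_succ', Equiv.Perm.mul_apply, hz] at hy
      obtain ⟨w, rfl, -, h2⟩ := exists_of_rot_up_eq_dn hM hy.symm
      have h3 := (jump_of_rot_up_eq_up hM h2).climbs.sameCycle
      exact h1.trans ((show M.opening.faceNext.SameCycle w (M.opening.faceNext w) by
        simp [Equiv.Perm.SameCycle.refl]).symm.trans h3)

/-- The opening has only one face. -/
theorem sameCycle_opening (hM : M.IsQuadrangulation) (x y : M.opening.Dart) :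
    M.opening.faceNext.SameCycle x y := by
  have h1 : ∀ n : ℕ, ∀ x : M.opening.Dart, M.opening.lab x = n + 1 →
      ∃ y, M.opening.faceNext.SameCycle x y ∧ M.opening.lab y = 1 := by
    intro n
    induction n with
    | zero => exact fun x hx => ⟨x, .refl _ _, by simpa using hx⟩
    | succ n ih =>
      intro x hx
      push_cast at hx
      obtain ⟨y, hxy, hy⟩ := exists_sameCycle_opening hM x (by omega)
      obtain ⟨z, hyz, hz⟩ := ih y (by omega)
      exact ⟨z, hxy.trans hyz, hz⟩
  have h2 : ∀ x y : M.opening.Dart, M.opening.lab x = 1 → M.opening.lab y = 1 →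
      M.opening.faceNext.SameCycle x y := by
    intro x y hx hy
    have hbase : ∀ x : M.opening.Dart, M.opening.lab x = 1 → M.origin (M.up x) = M.base := by
      intro x hx
      rw [← lam_eq_zero_iff hM, lam_up hM, hx]
      rfl
    obtain ⟨k, hk⟩ := (RotationSystem.origin_eq_iff.1
      ((hbase x hx).trans (hbase y hy).symm)).exists_nat_pow_eq
    -- No arc at the basepoint is downward, since its other end would have a negative label.
    refine sameCycle_opening_of_rot_pow hM k hk fun i _ hd => ?_
    have h3 := lam_nonneg (M.opp ((M.rot ^ i) (M.up x)))
    rw [hd, lam_rot_pow, lam_up hM] at h3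
    omega
  have hx := one_le_lab_opening hM x
  have hy := one_le_lab_opening hM y
  obtain ⟨x', hxx, hx'⟩ := h1 (M.opening.lab x - 1).toNat x (by omega)
  obtain ⟨y', hyy, hy'⟩ := h1 (M.opening.lab y - 1).toNat y (by omega)
  exact hxx.trans ((h2 x' y' hx' hy').trans hyy.symm)

end PointedDrawing

/-! ### Vertex, edge and parity counts. -/

theorem LabeledDrawing.IsClosure.card_dart {T : LabeledDrawing.{u}} {M : RotationSystem.{u}}
    {down : T.Dart → M.Dart} (h : T.IsClosure M down) :
    Nat.card M.Dart = Nat.card T.Dart * 2 := by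
  rw [← Nat.card_congr (Equiv.ofBijective _ h.bijective), Nat.card_sum, mul_two]

namespace PointedDrawing

variable {M N : PointedDrawing.{u}}

theorem openingVertex_origin (o : M.opening.Dart) :
    M.openingVertex (M.opening.origin o) = M.origin o.1 := rfl

theorem openingVertex_injective : Function.Injective M.openingVertex := by
  intro v w h
  obtain ⟨a, rfl⟩ := RotationSystem.exists_origin_eq v
  obtain ⟨b, rfl⟩ := RotationSystem.exists_origin_eq w
  exact RotationSystem.origin_eq_iff.2 (sameCycle_firstReturn M.rot M.IsOpeningCorner a b
    (RotationSystem.origin_eq_iff.1 h))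

theorem range_openingVertex (hM : M.IsQuadrangulation) : Set.range M.openingVertex = {M.base}ᶜ := by
  ext v
  constructor
  · rintro ⟨w, rfl⟩ h
    obtain ⟨a, rfl⟩ := RotationSystem.exists_origin_eq w
    have h1 := one_le_lab_opening hM a
    have h2 : M.opening.lab a = 0 := (lam_eq_zero_iff hM a.1).2 h
    omega
  · intro hv
    obtain ⟨d, rfl⟩ := RotationSystem.exists_origin_eq v
    obtain ⟨k, hk⟩ := exists_isDown hM d (fun h => hv ((lam_eq_zero_iff hM d).1 h))
    obtain ⟨o, ho⟩ := exists_dn_eq hM hk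
    refine ⟨M.opening.origin o, ?_⟩
    rw [openingVertex_origin, ← rot_dn, RotationSystem.origin_rot, ho,
      RotationSystem.origin_rot_pow]

theorem card_vertex (hM : M.IsQuadrangulation) : Nat.card M.Vertex = Nat.card M.opening.Vertex + 1 := by
  have h1 : (Set.range M.openingVertex).ncard = Nat.card M.opening.Vertex := by
    rw [← Set.image_univ, Set.ncard_image_of_injective _ openingVertex_injective, Set.ncard_univ]
    rfl
  have h2 := Set.ncard_add_ncard_compl ({M.base} : Set M.Vertex)
  rw [Set.ncard_singleton, ← range_openingVertex hM, h1] at h2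
  omega

theorem card_odd_opening (hM : M.IsQuadrangulation) :
    Nat.card {v : M.opening.Vertex // Odd (M.opening.label v)}
      = Nat.card {v : M.Vertex // Odd (M.distLabel v)} := by
  have h : M.openingVertex '' {v | Odd (M.opening.label v)} = {v | Odd (M.distLabel v)} := by
    ext v
    constructor
    · rintro ⟨w, hw, rfl⟩
      exact (Int.odd_coe_nat _).1 hw
    · intro hv
      -- The lost basepoint has distance 0, which is even.
      have hb : v ∈ ({M.base}ᶜ : Set M.Vertex) := by
        rintro rfl
        simp [distLabel] at hv
      rw [← range_openingVertex hM] at hb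
      obtain ⟨w, rfl⟩ := hb
      exact ⟨w, (Int.odd_coe_nat _).2 hv, rfl⟩
  have := Set.ncard_image_of_injective {v | Odd (M.opening.label v)} (openingVertex_injective (M := M))
  exact this.symm.trans (congrArg Set.ncard h)

theorem card_face_opening (hM : M.IsQuadrangulation) : Nat.card M.opening.Face = 1 := by
  obtain ⟨d⟩ := hM.isMap.1
  obtain ⟨o, -⟩ := exists_dn_or_up hM d
  refine Nat.card_eq_one_iff_unique.2 ⟨⟨fun f f' => ?_⟩, ⟨M.opening.rightFace o⟩⟩
  obtain ⟨a, rfl⟩ := RotationSystem.exists_rightFace_eq f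
  obtain ⟨b, rfl⟩ := RotationSystem.exists_rightFace_eq f'
  exact RotationSystem.rightFace_eq_iff.2 (sameCycle_opening hM a b)

theorem card_edge_opening (hM : M.IsQuadrangulation) : Nat.card M.opening.Edge = Nat.card M.Face := by
  have h1 := RotationSystem.card_dart_of_isQuadrangular hM.isQuadrangular
  have h2 := (isClosure_opening hM).card_dart
  have h3 := RotationSystem.card_dart_eq_two_mul_card_edge (M := M.opening.toRotationSystem)
  omega

theorem card_edge (hM : M.IsQuadrangulation) : Nat.card M.Edge = 2 * Nat.card M.Face := by
  have h1 := RotationSystem.card_dart_of_isQuadrangular hM.isQuadrangular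
  have h3 := RotationSystem.card_dart_eq_two_mul_card_edge (M := M.toRotationSystem)
  omega

theorem isWellLabeled_opening (hM : M.IsQuadrangulation) : M.opening.IsWellLabeled := by
  constructor
  · intro x
    change |M.opening.lab x - M.opening.lab (M.opening.opp x)| ≤ 1
    obtain ⟨y, h | h⟩ := exists_dn_or_up hM (M.rot (M.dn x))
    · obtain ⟨-, h | h⟩ := rot_of_rot_dn_eq_dn hM h <;> rw [h] <;> simp
    · obtain ⟨h1, h2⟩ := opp_of_rot_dn_eq_up hM h
      rw [h1, h2]
      simp
  · obtain ⟨d⟩ := hM.isMap.1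
    obtain ⟨o, -⟩ := exists_dn_or_up hM d
    have : Nonempty M.opening.Dart := ⟨o⟩
    obtain ⟨x, hx⟩ := Finite.exists_max M.opening.lab
    refine ⟨M.opening.lab x, one_le_lab_opening hM x, ?_⟩
    ext l
    constructor
    · rintro ⟨v, rfl⟩
      obtain ⟨a, rfl⟩ := RotationSystem.exists_origin_eq v
      exact ⟨one_le_lab_opening hM a, hx a⟩
    · rintro ⟨h1, h2⟩
      have key : ∀ n : ℕ, ∀ l, 1 ≤ l → l + n = M.opening.lab x →
          ∃ y, M.opening.lab y = l := by
        intro n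
        induction n with
        | zero => exact fun l _ h => ⟨x, by simpa using h.symm⟩
        | succ n ih =>
          intro l hl h
          obtain ⟨y, hy⟩ := ih (l + 1) (by omega) (by push_cast at h; omega)
          obtain ⟨z, -, hz⟩ := exists_sameCycle_opening hM y (by omega)
          exact ⟨z, by omega⟩
      obtain ⟨y, hy⟩ := key (M.opening.lab x - l).toNat l h1 (by omega)
      exact ⟨M.opening.origin y, hy⟩

theorem IsBipartiteQuadrangulation.isQuadrangulation {g n i : ℕ} (h : M.IsBipartiteQuadrangulation g n i) :
    M.IsQuadrangulation := ⟨h.1.1, h.2.1, h.2.2.1⟩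

theorem isWellLabeledTree_opening {g n i : ℕ} (h : M.IsBipartiteQuadrangulation g n i) :
    M.opening.IsWellLabeledTree g n i := by
  have hM := h.isQuadrangulation
  have : Nonempty M.opening.Dart := by
    obtain ⟨d⟩ := hM.isMap.1
    obtain ⟨o, -⟩ := exists_dn_or_up hM d
    exact ⟨o⟩
  have h1 := card_edge_opening hM
  refine ⟨⟨RotationSystem.isMap_of_sameCycle_faceNext (sameCycle_opening hM), ?_⟩,
    card_face_opening hM, isWellLabeled_opening hM, h1.trans h.2.2.2.1,
    (card_odd_opening hM).trans h.2.2.2.2⟩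
  -- With n faces and V vertices, V - 2n + n = (V - 1) - n + 1: the Euler characteristic is
  -- unchanged.
  have h2 := h.1.2
  have h3 := card_vertex hM
  have h4 := card_face_opening hM
  have h5 := card_edge hM
  omega

/-! ### The opening on isomorphism classes: well defined and injective. -/

theorem lam_iso (hM : M.IsQuadrangulation) (e : RotationSystem.Iso M.toRotationSystem N.toRotationSystem)
    (he : ∀ d, M.origin d = M.base ↔ N.origin (e.toEquiv d) = N.base) (d : M.Dart) :
    N.lam (e.toEquiv d) = M.lam d := by
  have key := RotationSystem.dist_eq_of_descent N.base
    (fun v => M.distLabel (e.vertexEquiv.symm v)) ?_ ?_ ?_ (N.origin (e.toEquiv d))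
  · rw [lam, distLabel, key, ← RotationSystem.Iso.vertexEquiv_origin, Equiv.symm_apply_apply, lam]
  · obtain ⟨d, hd⟩ := RotationSystem.exists_origin_eq M.base
    rw [← (he d).1 hd, ← RotationSystem.Iso.vertexEquiv_origin]
    simp [hd, distLabel]
  · intro d
    obtain ⟨d, rfl⟩ := e.toEquiv.surjective d
    rw [← e.map_opp, ← RotationSystem.Iso.vertexEquiv_origin,
      ← RotationSystem.Iso.vertexEquiv_origin, Equiv.symm_apply_apply, Equiv.symm_apply_apply]
    have := lam_opp hM d
    simp only [lam] at this
    omega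
  · intro v hv
    obtain ⟨d, rfl⟩ := RotationSystem.exists_origin_eq v
    obtain ⟨d, rfl⟩ := e.toEquiv.surjective d
    rw [← RotationSystem.Iso.vertexEquiv_origin, Equiv.symm_apply_apply]
    have hd : M.lam d ≠ 0 := fun h => hv ((he d).1 ((lam_eq_zero_iff hM d).1 h))
    obtain ⟨k, hk⟩ := exists_isDown hM d hd
    refine ⟨e.toEquiv ((M.rot ^ k) d), e.origin_eq_iff.2 (RotationSystem.origin_rot_pow k d), ?_⟩
    rw [← e.map_opp, ← RotationSystem.Iso.vertexEquiv_origin, Equiv.symm_apply_apply]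
    rw [IsDown, lam_rot_pow] at hk
    simp only [lam] at hk
    omega

/-- Isomorphic pointed quadrangulations have isomorphic openings. -/
theorem Equivalent.opening (hM : M.IsQuadrangulation) (hN : N.IsQuadrangulation) (h : M.Equivalent N) :
    M.opening.Equivalent N.opening := by
  obtain ⟨e, he⟩ := h
  have hl := lam_iso hM e he
  have hc : ∀ d, M.IsOpeningCorner d ↔ N.IsOpeningCorner (e.toEquiv d) := by
    intro d
    obtain ⟨d, rfl⟩ := M.rot.surjective d
    rw [isOpeningCorner_rot_iff hM, e.map_rot, isOpeningCorner_rot_iff hN, IsDown, IsDown,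
      ← e.map_opp, hl, hl]
  refine ⟨⟨e.toEquiv.subtypeEquiv hc, fun o => ?_, fun o => ?_⟩, fun o => ?_⟩
  · exact (firstReturn_conj e.toEquiv e.map_rot hc o).symm
  · refine N.partner_unique ?_ ?_ (N.partner_ne _) (N.rightFace_partner _)
    · intro h
      exact M.partner_ne o ((e.toEquiv.subtypeEquiv hc).injective h)
    · exact e.rightFace_eq_iff.2 (M.rightFace_partner o)
  · exact (hl o.1).symm

/-- Pointed quadrangulations with isomorphic openings are isomorphic. -/
theorem equivalent_of_opening (hM : M.IsQuadrangulation) (hN : N.IsQuadrangulation)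
    (h : M.opening.Equivalent N.opening) : M.Equivalent N := by
  obtain ⟨e, he⟩ := h
  have he' : ∀ d, M.opening.lab d = N.opening.lab (e.toEquiv d) := he
  obtain ⟨f, hf⟩ := (isClosure_opening hM).exists_iso (isClosure_opening hN) e he
  refine ⟨f, fun d => ?_⟩
  rw [← lam_eq_zero_iff hM, ← lam_eq_zero_iff hN]
  obtain ⟨o, rfl | rfl⟩ := exists_dn_or_up hM d
  · rw [hf, lam_dn, lam_dn, he']
  · rw [up, f.map_opp, hf, opp_dn, opp_dn, lam_up hM, lam_up hN, he']

end PointedDrawing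

/-! ### Construction of the closure of a well labeled tree. -/

namespace LabeledDrawing

/-- Well labeled trees of any genus, in terms of darts. -/
structure IsLabeledTree (T : LabeledDrawing.{u}) : Prop where
  sameCycle : ∀ d e, T.faceNext.SameCycle d e
  lab_opp_le : ∀ d, T.lab (T.opp d) ≤ T.lab d + 1
  one_le_lab : ∀ d, 1 ≤ T.lab d
  exists_lab_eq_one : ∃ d, T.lab d = 1
  exists_lab_lt : ∀ d, T.lab d ≠ 1 → ∃ e, T.lab e < T.lab d

variable {T : LabeledDrawing.{u}}

theorem IsWellLabeledTree.isLabeledTree {g n i : ℕ} (h : T.IsWellLabeledTree g n i) : T.IsLabeledTree := by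
  obtain ⟨hmap, hface, ⟨hstep, m, hm, hrange⟩, -, -⟩ := h
  have hmem : ∀ d, T.lab d ∈ Set.Icc 1 m := fun d => hrange ▸ ⟨_, rfl⟩
  have hex : ∃ d, T.lab d = 1 := by
    obtain ⟨v, hv⟩ : (1 : ℤ) ∈ Set.range T.label := by rw [hrange]; exact ⟨le_rfl, hm⟩
    obtain ⟨d, rfl⟩ := RotationSystem.exists_origin_eq v
    exact ⟨d, hv⟩
  refine ⟨RotationSystem.sameCycle_faceNext_of_card_face hface, fun d => ?_,
    fun d => (hmem d).1, hex, fun d hd => ?_⟩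
  · have := abs_le.1 (hstep d)
    simp only [lab]
    omega
  · obtain ⟨e, he⟩ := hex
    have := (hmem d).1
    exact ⟨e, by omega⟩

theorem IsLabeledTree.le_lab_opp (hT : T.IsLabeledTree) (d : T.Dart) : T.lab d ≤ T.lab (T.opp d) + 1 := by
  have := hT.lab_opp_le (T.opp d)
  rwa [T.opp_opp] at this

theorem IsLabeledTree.lab_faceNext_le (hT : T.IsLabeledTree) (d : T.Dart) :
    T.lab (T.faceNext d) ≤ T.lab d + 1 := by
  rw [lab_faceNext]
  exact hT.lab_opp_le d

theorem IsLabeledTree.le_lab_faceNext (hT : T.IsLabeledTree) (d : T.Dart) :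
    T.lab d ≤ T.lab (T.faceNext d) + 1 := by
  rw [lab_faceNext]
  exact hT.le_lab_opp d

theorem Climbs.of_climbs {l : ℤ} {a b c : T.Dart} (h : T.Climbs l a b) (h' : T.Climbs l a c)
    (hc : T.lab c < l) : T.Climbs l b c := by
  obtain ⟨k, rfl, hk⟩ := h
  obtain ⟨m, rfl, hm⟩ := h'
  have hkm : k ≤ m := by
    by_contra h
    have := hk m (by omega)
    omega
  obtain ⟨j, rfl⟩ := Nat.exists_eq_add_of_le hkm
  refine ⟨j, by rw [← Equiv.Perm.mul_apply, ← pow_add, add_comm], fun i hi => ?_⟩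
  rw [← Equiv.Perm.mul_apply, ← pow_add, add_comm]
  exact hm _ (by omega)

theorem jump_faceNext {z : T.Dart} (h : T.lab (T.faceNext z) = T.lab z) :
    T.Jump z (T.faceNext z) := ⟨h.symm, .refl _ _⟩

/-- Corners strictly between `y` and `w` have labels above that of `w`, so `v` cannot lie there.
Passing from `w` to `y` thus shortens the tour from `v`, which makes inductions along successive
upward arcs terminate. -/
theorem Jump.exists_pow_lt {y w v : T.Dart} (h : T.Jump y w) {K : ℕ} (hK : 0 < K)
    (hv : (T.faceNext ^ K) v = w) (hl : T.lab v ≤ T.lab w) :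
    ∃ K' < K, (T.faceNext ^ K') v = y := by
  obtain ⟨h1, k, hk, hk'⟩ := h
  rcases Nat.lt_or_ge k K with hlt | hge
  · obtain ⟨j, rfl⟩ := Nat.exists_eq_add_of_le (Nat.succ_le_of_lt hlt)
    refine ⟨j, by omega, (T.faceNext ^ (k + 1)).injective ?_⟩
    rw [← Equiv.Perm.mul_apply, ← pow_add]
    exact hv.trans hk.symm
  · obtain ⟨j, rfl⟩ := Nat.exists_eq_add_of_le hge
    have h2 := hk' j (by omega)
    rw [pow_add, Equiv.Perm.mul_apply, ← hv] at hk
    rw [(T.faceNext ^ K).injective hk] at h2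
    omega

/-- Take the first later corner whose label is at most that of `z`; labels fall by at most one per
step, so equality holds. -/
theorem IsLabeledTree.exists_jump_from (hT : T.IsLabeledTree) (z : T.Dart)
    (hz : T.lab (T.faceNext z) = T.lab z + 1) : ∃ y, T.Jump z y := by
  classical
  have hex : ∃ k, T.lab ((T.faceNext ^ k) (T.faceNext z)) ≤ T.lab z := by
    obtain ⟨k, hk⟩ := (hT.sameCycle (T.faceNext z) z).exists_nat_pow_eq
    exact ⟨k, by rw [hk]⟩
  have hk := Nat.find_spec hex
  have hmin := fun i (hi : i < Nat.find hex) => not_le.1 (Nat.find_min hex hi)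
  generalize Nat.find hex = k at hk hmin
  refine ⟨_, ?_, k, rfl, fun i hi => hmin i hi⟩
  refine le_antisymm ?_ hk
  cases k with
  | zero =>
    rw [pow_zero, Equiv.Perm.one_apply] at hk
    omega
  | succ k =>
    have h1 := hmin k (by omega)
    have h2 := hT.le_lab_faceNext ((T.faceNext ^ k) (T.faceNext z))
    rw [pow_succ', Equiv.Perm.mul_apply]
    omega

/-- Take the nearest corner backwards from `z` with label at most that of `faceNext z`; labels rise
by at most one, so equality holds. The tour is cyclic, so `faceNext z` itself is a candidate. -/
theorem IsLabeledTree.exists_jump_to (hT : T.IsLabeledTree) (z : T.Dart)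
    (hz : T.lab (T.faceNext z) ≠ T.lab z + 1) : ∃ y, T.Jump y (T.faceNext z) := by
  classical
  have hle := hT.lab_faceNext_le z
  have hex : ∃ k y, (T.faceNext ^ k) y = z ∧ T.lab y ≤ T.lab (T.faceNext z) := by
    obtain ⟨k, hk⟩ := (hT.sameCycle (T.faceNext z) z).exists_nat_pow_eq
    exact ⟨k, _, hk, le_rfl⟩
  have hk := Nat.find_spec hex
  have hmin := fun i (hi : i < Nat.find hex) => Nat.find_min hex hi
  generalize Nat.find hex = k at hk hmin
  obtain ⟨y, hy, hyl⟩ := hk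
  have hlt : ∀ i < k, T.lab (T.faceNext z) < T.lab ((T.faceNext ^ i) (T.faceNext y)) := by
    intro i hi
    by_contra h
    refine hmin (k - 1 - i) (by omega) ⟨_, ?_, not_lt.1 h⟩
    rw [← Equiv.Perm.mul_apply, ← pow_add, ← Equiv.Perm.mul_apply, ← pow_succ,
      show k - 1 - i + i + 1 = k by omega, hy]
  have hyl' : T.lab y = T.lab (T.faceNext z) := by
    refine le_antisymm hyl ?_
    cases k with
    | zero =>
      obtain rfl : y = z := hy
      omega
    | succ k =>
      have h1 := hlt 0 (by omega)
      rw [pow_zero, Equiv.Perm.one_apply] at h1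
      have h2 := hT.lab_faceNext_le y
      omega
  refine ⟨y, hyl', k, ?_, fun i hi => ?_⟩
  · rw [← Equiv.Perm.mul_apply, ← pow_succ, pow_succ', Equiv.Perm.mul_apply, hy]
  · have := hlt i hi
    omega

open Classical in
/-- The counterclockwise successor of an arc in the closure of `T`: `inl x` is the edge drawn from
the corner `x` to the next corner with a smaller label, `inr x` is its reverse. -/
noncomputable def closureRot (T : LabeledDrawing.{u}) (hT : T.IsLabeledTree) :
    T.Dart ⊕ T.Dart → T.Dart ⊕ T.Dart
  | .inl x => if T.lab (T.opp x) = T.lab x + 1 then .inr (T.opp x) else .inl (T.rot x)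
  | .inr x =>
    if h : T.lab (T.faceNext (T.faceNext.symm x)) = T.lab (T.faceNext.symm x) + 1 then
      .inl (hT.exists_jump_from _ h).choose
    else .inr (hT.exists_jump_to _ h).choose

theorem closureRot_inl_up (hT : T.IsLabeledTree) (x : T.Dart) (hx : T.lab (T.opp x) = T.lab x + 1) :
    T.closureRot hT (.inl x) = .inr (T.opp x) := if_pos hx

theorem closureRot_inl_down (hT : T.IsLabeledTree) (x : T.Dart) (hx : T.lab (T.opp x) ≠ T.lab x + 1) :
    T.closureRot hT (.inl x) = .inl (T.rot x) := if_neg hx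

theorem closureRot_inr_down (hT : T.IsLabeledTree) (z : T.Dart)
    (hz : T.lab (T.faceNext z) = T.lab z + 1) :
    ∃ y, T.Jump z y ∧ T.closureRot hT (.inr (T.faceNext z)) = .inl y := by
  have h : T.lab (T.faceNext (T.faceNext.symm (T.faceNext z)))
      = T.lab (T.faceNext.symm (T.faceNext z)) + 1 := by
    rwa [Equiv.symm_apply_apply]
  have h1 := (hT.exists_jump_from _ h).choose_spec
  refine ⟨(hT.exists_jump_from _ h).choose, ?_, dif_pos h⟩
  exact (congrArg (fun w => T.Jump w _) (Equiv.symm_apply_apply T.faceNext z)).mp h1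

theorem closureRot_inr_up (hT : T.IsLabeledTree) (z : T.Dart)
    (hz : T.lab (T.faceNext z) ≠ T.lab z + 1) :
    ∃ y, T.Jump y (T.faceNext z) ∧ T.closureRot hT (.inr (T.faceNext z)) = .inr y := by
  have h : T.lab (T.faceNext (T.faceNext.symm (T.faceNext z)))
      ≠ T.lab (T.faceNext.symm (T.faceNext z)) + 1 := by
    rwa [Equiv.symm_apply_apply]
  have h1 := (hT.exists_jump_to _ h).choose_spec
  refine ⟨(hT.exists_jump_to _ h).choose, ?_, dif_neg h⟩
  exact (congrArg (fun w => T.Jump _ (T.faceNext w))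
    (Equiv.symm_apply_apply T.faceNext z)).mp h1

theorem closureRot_injective (hT : T.IsLabeledTree) : Function.Injective (T.closureRot hT) := by
  have key : ∀ x x', T.closureRot hT (.inl x) ≠ T.closureRot hT (.inr x') := by
    intro x x' h
    obtain ⟨z, rfl⟩ := T.faceNext.surjective x'
    have h1 : T.faceNext (T.opp x) = T.rot x := by
      rw [RotationSystem.faceNext_apply, T.opp_opp]
    have h2 := T.lab_rot x
    by_cases hx : T.lab (T.opp x) = T.lab x + 1 <;>
      by_cases hz : T.lab (T.faceNext z) = T.lab z + 1
    · obtain ⟨y, hy, hy'⟩ := closureRot_inr_down hT z hz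
      simp [closureRot_inl_up hT x hx, hy'] at h
    -- A jump from `opp x` would have to end at its immediate successor `rot x`, whose label is
    -- smaller.
    · obtain ⟨y, hy, hy'⟩ := closureRot_inr_up hT z hz
      rw [closureRot_inl_up hT x hx, hy'] at h
      obtain rfl := Sum.inr_injective h
      have h3 := hy.2.unique (l := T.lab (T.opp x) + 1) (.refl _ _) (by have := hy.1; omega)
        (by rw [h1]; omega)
      have h4 := hy.1
      rw [h3, h1] at h4
      omega
    -- As `rot x` is the target of a jump, its predecessor `opp x` has no smaller label, hence an
    -- equal one. The jump then starts at `opp x`, so `z = opp x`, against `hz`.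
    · obtain ⟨y, hy, hy'⟩ := closureRot_inr_down hT z hz
      rw [closureRot_inl_down hT x hx, hy'] at h
      obtain rfl := Sum.inl_injective h
      rw [← h1] at hy
      have h3 := hy.le
      rw [h1] at h3
      have h4 := hT.lab_opp_le x
      have h5 : T.lab (T.faceNext (T.opp x)) = T.lab (T.opp x) := by rw [h1]; omega
      rw [hy.left_unique (jump_faceNext h5)] at hz
      omega
    · obtain ⟨y, hy, hy'⟩ := closureRot_inr_up hT z hz
      simp [closureRot_inl_down hT x hx, hy'] at h
  rintro (x | x) (x' | x') h
  · by_cases hx : T.lab (T.opp x) = T.lab x + 1 <;>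
      by_cases hx' : T.lab (T.opp x') = T.lab x' + 1
    · rw [closureRot_inl_up hT x hx, closureRot_inl_up hT x' hx'] at h
      rw [T.opp.injective (Sum.inr_injective h)]
    · simp [closureRot_inl_up hT x hx, closureRot_inl_down hT x' hx'] at h
    · simp [closureRot_inl_up hT x' hx', closureRot_inl_down hT x hx] at h
    · rw [closureRot_inl_down hT x hx, closureRot_inl_down hT x' hx'] at h
      rw [T.rot.injective (Sum.inl_injective h)]
  · exact absurd h (key _ _)
  · exact absurd h.symm (key _ _)
  · obtain ⟨z, rfl⟩ := T.faceNext.surjective x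
    obtain ⟨z', rfl⟩ := T.faceNext.surjective x'
    by_cases hz : T.lab (T.faceNext z) = T.lab z + 1 <;>
      by_cases hz' : T.lab (T.faceNext z') = T.lab z' + 1
    · obtain ⟨y, hy, hy'⟩ := closureRot_inr_down hT z hz
      obtain ⟨w, hw, hw'⟩ := closureRot_inr_down hT z' hz'
      rw [hy', hw'] at h
      obtain rfl := Sum.inl_injective h
      rw [hy.left_unique hw]
    · obtain ⟨y, hy, hy'⟩ := closureRot_inr_down hT z hz
      obtain ⟨w, hw, hw'⟩ := closureRot_inr_up hT z' hz'
      simp [hy', hw'] at h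
    · obtain ⟨y, hy, hy'⟩ := closureRot_inr_up hT z hz
      obtain ⟨w, hw, hw'⟩ := closureRot_inr_down hT z' hz'
      simp [hy', hw'] at h
    · obtain ⟨y, hy, hy'⟩ := closureRot_inr_up hT z hz
      obtain ⟨w, hw, hw'⟩ := closureRot_inr_up hT z' hz'
      rw [hy', hw'] at h
      obtain rfl := Sum.inr_injective h
      rw [hy.right_unique hw]

/-- The closure of a well labeled tree. -/
noncomputable def closureDrawing (T : LabeledDrawing.{u}) (hT : T.IsLabeledTree) : RotationSystem.{u} where
  Dart := T.Dart ⊕ T.Dart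
  finite := inferInstance
  rot := Equiv.ofBijective _ (Finite.injective_iff_bijective.1 (closureRot_injective hT))
  opp := Equiv.sumComm _ _
  opp_opp := by rintro (x | x) <;> rfl
  opp_ne := by rintro (x | x) <;> simp

/-- The edge drawn from a corner of `T` to the next corner with a smaller label. -/
def down (T : LabeledDrawing.{u}) (hT : T.IsLabeledTree) (x : T.Dart) : (T.closureDrawing hT).Dart :=
  Sum.inl x

theorem isClosure_closureDrawing (hT : T.IsLabeledTree) :
    T.IsClosure (T.closureDrawing hT) (T.down hT) where
  injective := Sum.inl_injective
  down_ne _ _ h := Sum.inl_ne_inr h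
  exists_eq := by
    rintro (x | x)
    exacts [⟨x, Or.inl rfl⟩, ⟨x, Or.inr rfl⟩]
  rot_down_up := closureRot_inl_up hT
  rot_down_down := closureRot_inl_down hT
  rot_up_down := closureRot_inr_down hT
  rot_up_up := closureRot_inr_up hT

end LabeledDrawing

/-! ### Distances in the closure. -/

namespace LabeledDrawing

variable {T : LabeledDrawing.{u}}

/-- The reverse of `down`. -/
def up (T : LabeledDrawing.{u}) (hT : T.IsLabeledTree) (x : T.Dart) : (T.closureDrawing hT).Dart :=
  Sum.inr x

theorem opp_down (hT : T.IsLabeledTree) (x : T.Dart) :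
    (T.closureDrawing hT).opp (T.down hT x) = T.up hT x := rfl

theorem opp_up (hT : T.IsLabeledTree) (x : T.Dart) :
    (T.closureDrawing hT).opp (T.up hT x) = T.down hT x := rfl

theorem down_or_up (hT : T.IsLabeledTree) (d : (T.closureDrawing hT).Dart) :
    ∃ x, d = T.down hT x ∨ d = T.up hT x := (isClosure_closureDrawing hT).exists_eq d

theorem up_injective (hT : T.IsLabeledTree) : Function.Injective (T.up hT) := Sum.inr_injective

/-- The distance to the basepoint of the origin of a dart of the closure. -/
def level (T : LabeledDrawing.{u}) (hT : T.IsLabeledTree) : (T.closureDrawing hT).Dart → ℤ :=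
  Sum.elim T.lab fun x => T.lab x - 1

@[simp] theorem level_down (hT : T.IsLabeledTree) (x : T.Dart) : T.level hT (T.down hT x) = T.lab x := rfl

@[simp] theorem level_up (hT : T.IsLabeledTree) (x : T.Dart) : T.level hT (T.up hT x) = T.lab x - 1 := rfl

theorem level_nonneg (hT : T.IsLabeledTree) (d : (T.closureDrawing hT).Dart) : 0 ≤ T.level hT d := by
  obtain ⟨x, rfl | rfl⟩ := down_or_up hT d
  · have := hT.one_le_lab x
    rw [level_down]
    omega
  · have := hT.one_le_lab x
    rw [level_up]
    omega

theorem level_rot (hT : T.IsLabeledTree) (d : (T.closureDrawing hT).Dart) :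
    T.level hT ((T.closureDrawing hT).rot d) = T.level hT d := by
  have hC := isClosure_closureDrawing hT
  obtain ⟨x, rfl | rfl⟩ := down_or_up hT d
  · by_cases hx : T.lab (T.opp x) = T.lab x + 1
    · rw [hC.rot_down_up x hx, opp_down, level_up, level_down, hx]
      omega
    · rw [hC.rot_down_down x hx, level_down, level_down, lab_rot]
  · obtain ⟨z, rfl⟩ := T.faceNext.surjective x
    rw [← opp_down]
    by_cases hz : T.lab (T.faceNext z) = T.lab z + 1
    · obtain ⟨y, hy, hy'⟩ := hC.rot_up_down z hz
      rw [hy', opp_down, level_up, level_down, ← hy.1]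
      omega
    · obtain ⟨y, hy, hy'⟩ := hC.rot_up_up z hz
      rw [hy', opp_down, opp_down, level_up, level_up, ← hy.1]

theorem level_rot_pow (hT : T.IsLabeledTree) (k : ℕ) (d : (T.closureDrawing hT).Dart) :
    T.level hT (((T.closureDrawing hT).rot ^ k) d) = T.level hT d := by
  induction k with
  | zero => rfl
  | succ k ih => rw [pow_succ', Equiv.Perm.mul_apply, level_rot, ih]

theorem level_eq_of_origin_eq (hT : T.IsLabeledTree) {d e : (T.closureDrawing hT).Dart}
    (h : (T.closureDrawing hT).origin d = (T.closureDrawing hT).origin e) :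
    T.level hT d = T.level hT e := by
  obtain ⟨k, rfl⟩ := (RotationSystem.origin_eq_iff.1 h).exists_nat_pow_eq
  rw [level_rot_pow]

/-- `level` as a function on the vertices. -/
noncomputable def vertexLevel (T : LabeledDrawing.{u}) (hT : T.IsLabeledTree)
    (v : (T.closureDrawing hT).Vertex) : ℤ :=
  T.level hT (RotationSystem.exists_origin_eq v).choose

theorem vertexLevel_origin (hT : T.IsLabeledTree) (d : (T.closureDrawing hT).Dart) :
    T.vertexLevel hT ((T.closureDrawing hT).origin d) = T.level hT d :=
  level_eq_of_origin_eq hT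
    (RotationSystem.exists_origin_eq ((T.closureDrawing hT).origin d)).choose_spec

/-- Turning around the end of the edge drawn from a corner `w`, one meets next the edge drawn from
the corner `y` at which that edge ends. -/
theorem exists_rot_pow_up (hT : T.IsLabeledTree) (w : T.Dart) (hw : T.lab w ≠ 1) :
    ∃ m y, ((T.closureDrawing hT).rot ^ (m + 1)) (T.up hT w) = T.down hT y ∧
      (∀ i ≤ m, ∃ x, ((T.closureDrawing hT).rot ^ i) (T.up hT w) = T.up hT x) ∧
      T.Climbs (T.lab w) w y ∧ T.lab y < T.lab w := by
  have hC := isClosure_closureDrawing hT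
  -- `K` is the length of the tour from a fixed corner `v` of smaller label; each turn to another
  -- upward arc decreases it.
  have key : ∀ K w, (∃ v, (T.faceNext ^ K) v = w ∧ T.lab v < T.lab w) →
      ∃ m y, ((T.closureDrawing hT).rot ^ (m + 1)) (T.up hT w) = T.down hT y ∧
      (∀ i ≤ m, ∃ x, ((T.closureDrawing hT).rot ^ i) (T.up hT w) = T.up hT x) ∧
      T.Climbs (T.lab w) w y ∧ T.lab y < T.lab w := by
    intro K
    induction K using Nat.strong_induction_on with
    | _ K ih =>
      rintro w ⟨v, hv, hlt⟩
      obtain ⟨z, rfl⟩ := T.faceNext.surjective w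
      by_cases hz : T.lab (T.faceNext z) = T.lab z + 1
      · obtain ⟨y, hy, hy'⟩ := hC.rot_up_down z hz
        refine ⟨0, y, hy', fun i hi => ?_, ?_, ?_⟩
        · obtain rfl : i = 0 := by omega
          exact ⟨_, rfl⟩
        · rw [hz]
          exact hy.2
        · rw [hz, ← hy.1]
          omega
      · obtain ⟨y, hy, hy'⟩ := hC.rot_up_up z hz
        have hK : 0 < K := by
          rcases Nat.eq_zero_or_pos K with rfl | h
          · obtain rfl : v = T.faceNext z := hv
            omega
          · exact h
        obtain ⟨K', hK', hv'⟩ := hy.exists_pow_lt hK hv hlt.le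
        obtain ⟨m, y', h1, h2, h3, h4⟩ := ih K' hK' y ⟨v, hv', by rw [hy.1]; exact hlt⟩
        have hy'' : (T.closureDrawing hT).rot (T.up hT (T.faceNext z)) = T.up hT y := hy'
        refine ⟨m + 1, y', ?_, ?_, ?_, by rw [← hy.1]; exact h4⟩
        · rw [pow_succ, Equiv.Perm.mul_apply, hy'', h1]
        · rintro (_ | i) hi
          · exact ⟨_, rfl⟩
          · rw [pow_succ, Equiv.Perm.mul_apply, hy'']
            exact h2 i (by omega)
        · rw [← hy.1]
          exact hy.climbs.of_climbs h3 h4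
  obtain ⟨e, he⟩ := hT.exists_lab_lt w hw
  obtain ⟨K, hK⟩ := (hT.sameCycle e w).exists_nat_pow_eq
  exact key K w ⟨e, hK, he⟩

/-- The edge from `opp u` ends at the very next corner `rot u`, which already has a smaller label.
-/
theorem exists_rot_pow_up_opp (hT : T.IsLabeledTree) (u : T.Dart) (hu : T.lab (T.opp u) = T.lab u + 1) :
    ∃ m, ((T.closureDrawing hT).rot ^ (m + 1)) (T.up hT (T.opp u)) = T.down hT (T.rot u) ∧
      ∀ i ≤ m, ∃ x, ((T.closureDrawing hT).rot ^ i) (T.up hT (T.opp u)) = T.up hT x := by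
  have h1 := hT.one_le_lab u
  obtain ⟨m, y, hm, hm', hy, hlt⟩ := exists_rot_pow_up hT (T.opp u) (by omega)
  refine ⟨m, ?_, hm'⟩
  have h2 : T.faceNext (T.opp u) = T.rot u := by rw [RotationSystem.faceNext_apply, T.opp_opp]
  rw [hm, hy.unique (Climbs.step le_rfl) hlt (by rw [h2, lab_rot]; omega), h2]

/-- No label is below 1, so rotation from these arcs always follows `rot_up_up` and visits the
corners of label 1 backwards along the tour. All their edges end at one vertex, the additional one.
-/
theorem origin_up_eq (hT : T.IsLabeledTree) {x y : T.Dart} (hx : T.lab x = 1) (hy : T.lab y = 1) :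
    (T.closureDrawing hT).origin (T.up hT x) = (T.closureDrawing hT).origin (T.up hT y) := by
  have hC := isClosure_closureDrawing hT
  obtain ⟨K, hK⟩ := (hT.sameCycle y x).exists_nat_pow_eq
  induction K using Nat.strong_induction_on generalizing x with
  | _ K ih =>
    rcases Nat.eq_zero_or_pos K with rfl | hpos
    · obtain rfl : y = x := hK
      rfl
    · obtain ⟨z, rfl⟩ := T.faceNext.surjective x
      obtain ⟨w, hw, hw'⟩ := hC.rot_up_up z (by have := hT.one_le_lab z; omega)
      obtain ⟨K', hK', h⟩ := hw.exists_pow_lt hpos hK (by omega)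
      rw [← ih K' hK' (hw.1.trans hx) h, ← RotationSystem.origin_rot]
      exact congrArg _ hw'

/-- The closure of a well labeled tree, pointed at the additional vertex. -/
noncomputable def closure (T : LabeledDrawing.{u}) (hT : T.IsLabeledTree) : PointedDrawing.{u} where
  toRotationSystem := T.closureDrawing hT
  base := (T.closureDrawing hT).origin (T.up hT hT.exists_lab_eq_one.choose)

theorem closure_base (hT : T.IsLabeledTree) {x : T.Dart} (hx : T.lab x = 1) :
    (T.closure hT).base = (T.closureDrawing hT).origin (T.up hT x) :=
  origin_up_eq hT hT.exists_lab_eq_one.choose_spec hx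

theorem level_opp (hT : T.IsLabeledTree) (d : (T.closureDrawing hT).Dart) :
    T.level hT ((T.closureDrawing hT).opp d) = T.level hT d - 1 ∨
      T.level hT ((T.closureDrawing hT).opp d) = T.level hT d + 1 := by
  obtain ⟨x, rfl | rfl⟩ := down_or_up hT d
  · exact Or.inl (by rw [opp_down, level_up, level_down])
  · exact Or.inr (by rw [opp_up, level_up, level_down]; omega)

theorem isBipartite_closureDrawing (hT : T.IsLabeledTree) : (T.closureDrawing hT).IsBipartite := by
  refine ⟨fun v => decide (Even (T.vertexLevel hT v)), fun d => ?_⟩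
  simp only [vertexLevel_origin, ne_eq, decide_eq_decide]
  rcases level_opp hT d with h | h <;> rw [h]
  · rw [Int.even_sub_one]; tauto
  · rw [Int.even_add_one]; tauto

theorem lam_closure (hT : T.IsLabeledTree) (d : (T.closureDrawing hT).Dart) :
    (T.closure hT).lam d = T.level hT d := by
  have key := RotationSystem.dist_eq_of_descent (M := T.closureDrawing hT) (T.closure hT).base
    (fun v => (T.vertexLevel hT v).toNat) ?_ ?_ ?_ ((T.closureDrawing hT).origin d)
  · refine (congrArg Int.ofNat key).trans ?_
    simp only [vertexLevel_origin]
    exact Int.toNat_of_nonneg (level_nonneg hT d)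
  · obtain ⟨x, hx⟩ := hT.exists_lab_eq_one
    have h := (congrArg (T.vertexLevel hT) (closure_base hT hx)).trans (vertexLevel_origin hT _)
    rw [level_up, hx] at h
    exact congrArg Int.toNat h
  · intro d
    simp only [vertexLevel_origin]
    rcases level_opp hT d with h | h <;> rw [h] <;> omega
  · intro v hv
    have hdown : ∀ x, (T.closureDrawing hT).origin (T.down hT x) = v →
        ∃ d, (T.closureDrawing hT).origin d = v ∧
        (T.vertexLevel hT ((T.closureDrawing hT).origin ((T.closureDrawing hT).opp d))).toNat + 1
          = (T.vertexLevel hT v).toNat := by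
      rintro x rfl
      refine ⟨T.down hT x, rfl, ?_⟩
      have := hT.one_le_lab x
      rw [vertexLevel_origin, vertexLevel_origin, opp_down, level_up, level_down]
      omega
    obtain ⟨d, rfl⟩ := RotationSystem.exists_origin_eq v
    obtain ⟨x, rfl | rfl⟩ := down_or_up hT d
    · exact hdown x rfl
    -- An upward arc of label 1 starts at the basepoint; from any other, turning reaches a downward
    -- arc at the same vertex.
    · by_cases hx : T.lab x = 1
      · exact absurd (closure_base hT hx).symm hv
      · obtain ⟨m, y, h, -⟩ := exists_rot_pow_up hT x hx
        refine hdown y ?_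
        rw [← h, RotationSystem.origin_rot_pow]

/-! ### The faces of the closure. -/

section Faces

variable (hT : T.IsLabeledTree)

theorem faceNext_up_of_lt (y : T.Dart) (hy : T.lab (T.opp y) = T.lab y + 1) :
    (T.closureDrawing hT).faceNext (T.up hT y) = T.up hT (T.opp y) :=
  (isClosure_closureDrawing hT).rot_down_up y hy

theorem faceNext_up_of_ne (y : T.Dart) (hy : T.lab (T.opp y) ≠ T.lab y + 1) :
    (T.closureDrawing hT).faceNext (T.up hT y) = T.down hT (T.rot y) :=
  (isClosure_closureDrawing hT).rot_down_down y hy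

theorem exists_faceNext_down_faceNext (z : T.Dart) (hz : T.lab (T.faceNext z) = T.lab z + 1) :
    ∃ y, T.Jump z y ∧ (T.closureDrawing hT).faceNext (T.down hT (T.faceNext z)) = T.down hT y :=
  (isClosure_closureDrawing hT).rot_up_down z hz

theorem exists_faceNext_down (z : T.Dart) (hz : T.lab (T.faceNext z) ≠ T.lab z + 1) :
    ∃ y, T.Jump y (T.faceNext z) ∧
      (T.closureDrawing hT).faceNext (T.down hT (T.faceNext z)) = T.up hT y :=
  (isClosure_closureDrawing hT).rot_up_up z hz

theorem faceNext_down_of_jump {y s : T.Dart} (h : T.Jump y s) :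
    (T.closureDrawing hT).faceNext (T.down hT s) = T.up hT y := by
  obtain ⟨z, rfl⟩ := T.faceNext.surjective s
  obtain ⟨w, hw, hw'⟩ := exists_faceNext_down hT z (by have := h.le; omega)
  rw [hw', h.left_unique hw]

theorem faceNext_down_rot (y : T.Dart) (hy : T.lab (T.opp y) = T.lab y) :
    (T.closureDrawing hT).faceNext (T.down hT (T.rot y)) = T.up hT (T.opp y) := by
  have h : T.faceNext (T.opp y) = T.rot y := by rw [RotationSystem.faceNext_apply, T.opp_opp]
  rw [← h]
  exact faceNext_down_of_jump hT (jump_faceNext (by rw [h, lab_rot, hy]))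

/-- Each edge of `T` lies in one face. If its ends have equal labels the border is up, down, up,
down; otherwise it is up, up, down, down, starting from the lower end. Both upward arcs come from
the two arcs of that edge. -/
theorem faceNext_four_up (y : T.Dart) :
    (T.closureDrawing hT).faceNext ((T.closureDrawing hT).faceNext
      ((T.closureDrawing hT).faceNext ((T.closureDrawing hT).faceNext (T.up hT y)))) = T.up hT y ∧
    (T.closureDrawing hT).faceNext ((T.closureDrawing hT).faceNext (T.up hT y)) ≠ T.up hT y ∧
    (T.closureDrawing hT).rightFace (T.up hT (T.opp y))
      = (T.closureDrawing hT).rightFace (T.up hT y) := by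
  have key : ∀ y, T.lab (T.opp y) = T.lab y + 1 →
      (T.closureDrawing hT).faceNext (T.up hT y) = T.up hT (T.opp y) ∧
      ∃ a b, (T.closureDrawing hT).faceNext (T.up hT (T.opp y)) = T.down hT a ∧
      (T.closureDrawing hT).faceNext (T.down hT a) = T.down hT b ∧
      (T.closureDrawing hT).faceNext (T.down hT b) = T.up hT y := by
    intro y hy
    have h2 := faceNext_up_of_ne hT (T.opp y) (by rw [T.opp_opp, hy]; omega)
    obtain ⟨s, hs, hs'⟩ := exists_faceNext_down_faceNext hT y (by rw [lab_faceNext, hy])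
    exact ⟨faceNext_up_of_lt hT y hy, _, s, h2, hs', faceNext_down_of_jump hT hs⟩
  have hf := RotationSystem.rightFace_faceNext (M := T.closureDrawing hT)
  rcases lt_trichotomy (T.lab (T.opp y)) (T.lab y) with hy | hy | hy
  · obtain ⟨h1, a, b, h2, h3, h4⟩ := key (T.opp y)
      (by rw [T.opp_opp]; have := hT.le_lab_opp y; omega)
    rw [T.opp_opp] at h1 h2
    rw [h2, h3, h4, h1]
    refine ⟨rfl, fun h => Sum.inl_ne_inr h, ?_⟩
    rw [← h1, hf]
  · have h1 := faceNext_up_of_ne hT y (by omega)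
    have h2 := faceNext_down_rot hT y hy
    have h3 := faceNext_up_of_ne hT (T.opp y) (by rw [T.opp_opp]; omega)
    have h4 := faceNext_down_rot hT (T.opp y) (by rw [T.opp_opp, hy])
    rw [T.opp_opp] at h4
    rw [h1, h2, h3, h4]
    refine ⟨rfl, fun h => T.opp_ne y (up_injective hT h), ?_⟩
    rw [← h2, hf, ← h1, hf]
  · obtain ⟨h1, a, b, h2, h3, h4⟩ := key y (by have := hT.lab_opp_le y; omega)
    rw [h1, h2, h3, h4]
    refine ⟨rfl, fun h => Sum.inl_ne_inr h, ?_⟩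
    rw [← h1, hf]

theorem isQuadrangular_closureDrawing : (T.closureDrawing hT).IsQuadrangular := by
  intro f
  obtain ⟨d, rfl⟩ := RotationSystem.exists_rightFace_eq f
  rw [RotationSystem.faceDegree_eq_minimalPeriod]
  suffices h : (T.closureDrawing hT).faceNext ((T.closureDrawing hT).faceNext
      ((T.closureDrawing hT).faceNext ((T.closureDrawing hT).faceNext d))) = d ∧
      (T.closureDrawing hT).faceNext ((T.closureDrawing hT).faceNext d) ≠ d by
    -- The period divides 4 = 2² but not 2, so it is 4.
    have := Fact.mk Nat.prime_two
    exact Function.minimalPeriod_eq_prime_pow (p := 2) (k := 1) h.2 h.1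
  have hinj := (T.closureDrawing hT).faceNext.injective
  -- The two conditions pass back from `faceNext d` to `d`, and a downward arc is followed by an
  -- upward one after at most two steps.
  have hup : ∀ d x, (T.closureDrawing hT).faceNext d = T.up hT x →
      (T.closureDrawing hT).faceNext ((T.closureDrawing hT).faceNext
      ((T.closureDrawing hT).faceNext ((T.closureDrawing hT).faceNext d))) = d ∧
      (T.closureDrawing hT).faceNext ((T.closureDrawing hT).faceNext d) ≠ d := by
    intro d x h
    obtain ⟨h1, h2, -⟩ := faceNext_four_up hT x
    rw [← h] at h1 h2
    exact ⟨hinj h1, fun h => h2 (congrArg _ h)⟩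
  obtain ⟨x, rfl | rfl⟩ := down_or_up hT d
  · obtain ⟨z, rfl⟩ := T.faceNext.surjective x
    by_cases hz : T.lab (T.faceNext z) = T.lab z + 1
    · obtain ⟨s, hs, hs'⟩ := exists_faceNext_down_faceNext hT z hz
      obtain ⟨h1, h2⟩ := hup _ _ (faceNext_down_of_jump hT hs)
      rw [← hs'] at h1 h2
      exact ⟨hinj h1, fun h => h2 (congrArg _ h)⟩
    · obtain ⟨y, -, hy⟩ := exists_faceNext_down hT z hz
      exact hup _ _ hy
  · obtain ⟨h1, h2, -⟩ := faceNext_four_up hT x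
    exact ⟨h1, h2⟩

end Faces

/-- The upward arcs of `x` and `opp x` share a face, and the downward arcs of `x` and `rot x` share
a vertex, so connectedness follows from the face tour of `T`. -/
theorem isMap_closureDrawing (hT : T.IsLabeledTree) : (T.closureDrawing hT).IsMap := by
  set C := T.closureDrawing hT
  set G := Subgroup.closure ({C.rot, C.opp} : Set (Equiv.Perm C.Dart))
  have hrot : C.rot ∈ G := Subgroup.subset_closure (by simp)
  have hopp : C.opp ∈ G := Subgroup.subset_closure (by simp)
  let R : C.Dart → C.Dart → Prop := fun d e => ∃ p ∈ G, p d = e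
  have trans : ∀ {a b c}, R a b → R b c → R a c := by
    rintro a b c ⟨p, hp, rfl⟩ ⟨q, hq, rfl⟩
    exact ⟨q * p, mul_mem hq hp, rfl⟩
  have symm : ∀ {a b}, R a b → R b a := by
    rintro a b ⟨p, hp, rfl⟩
    exact ⟨p⁻¹, inv_mem hp, Equiv.symm_apply_apply _ _⟩
  have hud : ∀ x, R (T.up hT x) (T.down hT x) := fun x => ⟨_, hopp, rfl⟩
  have huu : ∀ x, R (T.up hT x) (T.up hT (T.opp x)) := fun x => by
    obtain ⟨k, hk⟩ := RotationSystem.rightFace_eq_iff.1 (faceNext_four_up hT x).2.2.symm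
    exact ⟨_, zpow_mem RotationSystem.faceNext_mem_closure k, hk⟩
  have hdd : ∀ x, R (T.down hT x) (T.down hT (T.rot x)) := by
    intro x
    by_cases hx : T.lab (T.opp x) = T.lab x + 1
    · obtain ⟨m, hm, -⟩ := exists_rot_pow_up_opp hT x hx
      exact trans (symm (hud x)) (trans (huu x) ⟨_, pow_mem hrot _, hm⟩)
    · exact ⟨_, hrot, (isClosure_closureDrawing hT).rot_down_down x hx⟩
  have hface : ∀ x, R (T.down hT x) (T.down hT (T.faceNext x)) := fun x =>
    trans (symm (hud x)) (trans (huu x) (trans (hud _) (hdd _)))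
  have hall : ∀ x y, R (T.down hT x) (T.down hT y) := by
    intro x y
    obtain ⟨k, rfl⟩ := (hT.sameCycle x y).exists_nat_pow_eq
    induction k with
    | zero => exact ⟨1, one_mem _, rfl⟩
    | succ k ih =>
      rw [pow_succ', Equiv.Perm.mul_apply]
      exact trans ih (hface _)
  have hto : ∀ d, ∃ x, R d (T.down hT x) := by
    intro d
    obtain ⟨x, rfl | rfl⟩ := down_or_up hT d
    exacts [⟨x, 1, one_mem _, rfl⟩, ⟨x, hud x⟩]
  obtain ⟨x, -⟩ := hT.exists_lab_eq_one
  refine ⟨⟨T.down hT x⟩, fun d e => ?_⟩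
  obtain ⟨a, ha⟩ := hto d
  obtain ⟨b, hb⟩ := hto e
  exact trans ha (trans (hall a b) (symm hb))

theorem isQuadrangulation_closure (hT : T.IsLabeledTree) : (T.closure hT).IsQuadrangulation :=
  ⟨isMap_closureDrawing hT, isQuadrangular_closureDrawing hT, isBipartite_closureDrawing hT⟩

/-! ### Opening the closure recovers the tree. -/

theorem isDown_closure_iff (hT : T.IsLabeledTree) (d : (T.closureDrawing hT).Dart) :
    (T.closure hT).IsDown d ↔ ∃ x, d = T.down hT x := by
  have h : (T.closure hT).IsDown d
      ↔ T.level hT ((T.closureDrawing hT).opp d) = T.level hT d - 1 := by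
    rw [← lam_closure, ← lam_closure]
    rfl
  rw [h]
  constructor
  · intro h
    obtain ⟨x, rfl | rfl⟩ := down_or_up hT d
    · exact ⟨x, rfl⟩
    · rw [opp_up, level_down, level_up] at h
      omega
  · rintro ⟨x, rfl⟩
    rfl

theorem exists_dn_closure (hT : T.IsLabeledTree) (x : T.Dart) :
    ∃ o, (T.closure hT).dn o = T.down hT x :=
  PointedDrawing.exists_dn_eq (isQuadrangulation_closure hT) ((isDown_closure_iff hT _).2 ⟨x, rfl⟩)

/-- The opening of the closure of `T` is `T`. -/
theorem opening_closure (hT : T.IsLabeledTree) : T.Equivalent (T.closure hT).opening := by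
  have hM := isQuadrangulation_closure hT
  choose E hE using exists_dn_closure hT
  have hbij : Function.Bijective E := by
    constructor
    · intro x y h
      have := hE x
      rw [h, hE y] at this
      exact (Sum.inl_injective this).symm
    · intro o
      obtain ⟨x, hx⟩ := (isDown_closure_iff hT _).1 (PointedDrawing.isDown_dn hM o)
      exact ⟨x, PointedDrawing.dn_injective ((hE x).trans hx.symm)⟩
  have hup : ∀ x, (T.closure hT).up (E x) = T.up hT x := fun x =>
    congrArg (T.closureDrawing hT).opp (hE x)
  refine ⟨⟨Equiv.ofBijective E hbij, fun x => ?_, fun x => ?_⟩, fun x => ?_⟩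
  · symm
    change (T.closure hT).opening.rot (E x) = E (T.rot x)
    by_cases hx : T.lab (T.opp x) = T.lab x + 1
    · have h1 : (T.closureDrawing hT).rot (T.down hT x) = T.up hT (T.opp x) :=
        (isClosure_closureDrawing hT).rot_down_up x hx
      obtain ⟨m, hm, hm'⟩ := exists_rot_pow_up_opp hT x hx
      -- Only upward arcs separate `down x` from `down (rot x)`, and the first return skips them.
      refine PointedDrawing.opening_rot_eq hM (m + 1) ?_ fun i hi => ?_
      · rw [pow_succ, Equiv.Perm.mul_apply, hE, hE]
        exact (congrArg _ h1).trans hm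
      · rw [pow_succ, Equiv.Perm.mul_apply, hE]
        obtain ⟨w, hw⟩ := hm' i (by omega)
        rw [show ((T.closure hT).rot ^ i) ((T.closure hT).rot (T.down hT x)) = T.up hT w from
          (congrArg _ h1).trans hw, isDown_closure_iff]
        rintro ⟨y, hy⟩
        exact Sum.inr_ne_inl hy
    · refine PointedDrawing.opening_rot_of_rot_dn hM ?_
      rw [hE, hE]
      exact (isClosure_closureDrawing hT).rot_down_down x hx
  · symm
    refine PointedDrawing.opening_opp_eq ?_ ?_
    · change (T.closure hT).up (E (T.opp x)) ≠ (T.closure hT).up (E x)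
      rw [hup, hup]
      exact fun h => T.opp_ne x (up_injective hT h)
    · change (T.closure hT).rightFace ((T.closure hT).up (E (T.opp x)))
        = (T.closure hT).rightFace ((T.closure hT).up (E x))
      rw [hup, hup]
      exact (faceNext_four_up hT x).2.2
  · change T.lab x = (T.closure hT).opening.lab (E x)
    rw [← PointedDrawing.lam_dn, hE, lam_closure, level_down]

theorem Equivalent.card_eq {S T : LabeledDrawing.{u}} (h : S.Equivalent T) :
    Nat.card S.Dart = Nat.card T.Dart ∧ Nat.card S.Vertex = Nat.card T.Vertex ∧
      Nat.card {v : S.Vertex // Odd (S.label v)} = Nat.card {v : T.Vertex // Odd (T.label v)} := by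
  obtain ⟨e, he⟩ := h
  refine ⟨Nat.card_congr e.toEquiv, Nat.card_congr e.vertexEquiv,
    Nat.card_congr (e.vertexEquiv.subtypeEquiv fun v => ?_)⟩
  obtain ⟨d, rfl⟩ := RotationSystem.exists_origin_eq v
  rw [e.vertexEquiv_origin, he]

theorem isBipartiteQuadrangulation_closure {g n i : ℕ} (h : T.IsWellLabeledTree g n i)
    (hT : T.IsLabeledTree) : (T.closure hT).IsBipartiteQuadrangulation g n i := by
  have hM := isQuadrangulation_closure hT
  -- All counts for the closure are read off from its opening, which is isomorphic to `T`.
  obtain ⟨h1, h2, h3⟩ := (opening_closure hT).card_eq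
  obtain ⟨⟨-, hg⟩, hf, -, he, hi⟩ := h
  have h4 := PointedDrawing.card_vertex hM
  have h5 := PointedDrawing.card_edge hM
  have h6 := PointedDrawing.card_edge_opening hM
  have h7 := RotationSystem.card_dart_eq_two_mul_card_edge (M := T.toRotationSystem)
  have h8 := RotationSystem.card_dart_eq_two_mul_card_edge
    (M := (T.closure hT).opening.toRotationSystem)
  refine ⟨⟨hM.isMap, ?_⟩, hM.isQuadrangular, hM.isBipartite, by omega, ?_⟩
  · omega
  · rw [← PointedDrawing.card_odd_opening hM, ← h3, hi]

end LabeledDrawing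

/-- The opening is a bijection (between isomorphism classes); the numbers of edges and vertices are
as claimed on both sides; the vertices of the opening are the vertices of the quadrangulation other
than the basepoint, and their labels are the distances to the basepoint. -/
theorem theorem1 (g n i : ℕ) (hn : 1 ≤ n) :
    (∃ Φ : PointedBipartiteQuadrangulation.{u} g n i → WellLabeledTree.{u} g n i,
      Function.Bijective Φ ∧
      ∀ (M : PointedDrawing.{u}) (hM : M.IsBipartiteQuadrangulation g n i),
        (∃ hT : M.opening.IsWellLabeledTree g n i,
          Φ (PointedBipartiteQuadrangulation.mk M hM) = WellLabeledTree.mk M.opening hT) ∧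
        Function.Injective M.openingVertex ∧
        Set.range M.openingVertex = {M.base}ᶜ ∧
        ∀ v : M.opening.Vertex,
          M.opening.label v = (M.graph.dist M.base (M.openingVertex v) : ℤ)) ∧
    (∀ M : PointedDrawing.{u}, M.IsBipartiteQuadrangulation g n i →
      Nat.card M.Edge = 2 * n ∧ (Nat.card M.Vertex : ℤ) = (n : ℤ) + 2 - 2 * (g : ℤ)) ∧
    (∀ T : LabeledDrawing.{u}, T.IsWellLabeledTree g n i →
      (Nat.card T.Vertex : ℤ) = (n : ℤ) + 1 - 2 * (g : ℤ)) := by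
  refine ⟨⟨Quotient.map (fun M => ⟨M.1.opening, PointedDrawing.isWellLabeledTree_opening M.2⟩)
    fun M N h => PointedDrawing.Equivalent.opening M.2.isQuadrangulation N.2.isQuadrangulation h, ⟨?_, ?_⟩, ?_⟩, ?_, ?_⟩
  · intro a b
    induction a using Quotient.inductionOn with
    | _ M =>
      induction b using Quotient.inductionOn with
      | _ N =>
        intro h
        exact Quotient.sound
          (PointedDrawing.equivalent_of_opening M.2.isQuadrangulation N.2.isQuadrangulation (Quotient.exact h))
  · intro a
    induction a using Quotient.inductionOn with
    | _ T =>
      have hT := T.2.isLabeledTree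
      refine ⟨PointedBipartiteQuadrangulation.mk _
        (LabeledDrawing.isBipartiteQuadrangulation_closure T.2 hT), Quotient.sound ?_⟩
      exact LabeledDrawing.equivalent_equivalence.symm (LabeledDrawing.opening_closure hT)
  · exact fun M hM => ⟨⟨PointedDrawing.isWellLabeledTree_opening hM, rfl⟩,
      PointedDrawing.openingVertex_injective, PointedDrawing.range_openingVertex hM.isQuadrangulation,
      fun _ => rfl⟩
  · intro M hM
    have h1 := PointedDrawing.card_edge hM.isQuadrangulation
    have h2 := hM.1.2
    have h3 := hM.2.2.2.1
    omega
  · rintro T ⟨⟨-, hg⟩, hf, -, he, -⟩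
    omega
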